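/- Let $X$ be a complex algebraic variety (a reduced separated scheme of finite type over $\mathbb{C}$, possibly reducible and singular; for example a quasi-projective variety), all of whose irreducible components have the same dimension $n$. Let ${\bf K}_{rat}(X)$ be the collection of all finite dimensional complex vector spaces $L$ of rational functions on $X$ whose restriction to every irreducible component of $X$ is non-zero. A closed subset $\Sigma\subset X$ is called admissible for $L_1,\dots,L_n\in{\bf K}_{rat}(X)$ if $\dim\Sigma<n$, $\Sigma$ contains the singular locus of $X$, and, for each $i$, $\Sigma$ contains every irreducible divisor on which some function of $L_i$ has a pole and contains the base locus of $L_i$ (the set of points at which all functions of $L_i$ vanish). The birationally invariant intersection index $[L_1,\dots,L_n]$ is the maximum of the number of solutions in $X\setminus\Sigma$ of a system $f_1=\dots=f_n=0$, taken over all $(f_1,\dots,f_n)\in L_1\times\dots\times L_n$ for which this number is finite, where $\Sigma$ is any admissible set. It is well defined: admissible sets exist, and for each of them the maximum exists and has the same value. Moreover: 1) $[L_1,\dots,L_n]$ is a symmetric function of $L_1,\dots,L_n\in{\bf K}_{rat}(X)$, i.e. it takes the same value under any permutation of $L_1,\dots,L_n$. 2) The index is monotone: if $L'_i, L_i\in{\bf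 K}_{rat}(X)$ and $L'_i\subseteq L_i$ for $i=1,\dots,n$, then $[L_1,\dots,L_n]\geq[L'_1,\dots,L'_n]$. 3) The index is non-negative: $[L_1,\dots,L_n]\geq 0$. -/

import Mathlib

open AlgebraicGeometry CategoryTheory

noncomputable section

/-- A complex algebraic variety: a reduced, separated scheme of finite type over `ℂ`.
It may be reducible and singular. -/
structure ComplexVariety where
  /-- the underlying scheme -/
  scheme : Scheme.{0}
  /-- the structure morphism -/
  str : scheme ⟶ Spec (CommRingCat.of ℂ)
  reduced : IsReduced scheme
  separated : IsSeparated str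
  locallyOfFiniteType : LocallyOfFiniteType str
  quasiCompact : QuasiCompact str

namespace ComplexVariety

attribute [instance] reduced separated locallyOfFiniteType quasiCompact

variable (X : ComplexVariety)

/-- All irreducible components of `X` have dimension `n`. -/
def IsEquidimensional (n : ℕ) : Prop :=
  ∀ Z ∈ irreducibleComponents X.scheme, topologicalKrullDim Z = n

/-- The generic points of (the irreducible components of) `X`. -/
def GenericPoint : Type :=
  {x : X.scheme // closure {x} ∈ irreducibleComponents X.scheme}

/-- The ring of rational functions on the reduced scheme `X`: the product of the local rings
(which are fields) at the generic points, that is, the product of the function fields of the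
irreducible components. The `η`-coordinate of a rational function is its restriction to the
component with generic point `η`. -/
abbrev RatFun : Type :=
  ∀ η : X.GenericPoint, X.scheme.presheaf.stalk η.1

/-- The inclusion of the constants into a local ring of `X`. -/
def constStalk (x : X.scheme) : ℂ →+* X.scheme.presheaf.stalk x :=
  ((Scheme.ΓSpecIso (CommRingCat.of ℂ)).inv ≫ X.str.appTop ≫
    X.scheme.presheaf.germ ⊤ x trivial).hom

instance algebraStalk (x : X.scheme) : Algebra ℂ (X.scheme.presheaf.stalk x) :=
  (X.constStalk x).toAlgebra

variable {X}

/-- The regular function `s` on the open set `U` represents the rational function `f` on `U`: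
at every generic point contained in `U` its germ is the corresponding coordinate of `f`. -/
def RatFun.IsRepresentedBy (f : X.RatFun) (U : X.scheme.Opens) (s : Γ(X.scheme, U)) : Prop :=
  ∀ (η : X.GenericPoint) (h : η.1 ∈ U), X.scheme.presheaf.germ U η.1 h s = f η

/-- The rational function `f` is regular at the point `x`. -/
def RatFun.IsRegularAt (f : X.RatFun) (x : X.scheme) : Prop :=
  ∃ (U : X.scheme.Opens) (s : Γ(X.scheme, U)), x ∈ U ∧ RatFun.IsRepresentedBy f U s

/-- The rational function `f` is regular at `x` and its value there, in the residue field
of `x`, is zero. -/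
def RatFun.VanishesAt (f : X.RatFun) (x : X.scheme) : Prop :=
  ∃ (U : X.scheme.Opens) (s : Γ(X.scheme, U)) (h : x ∈ U), RatFun.IsRepresentedBy f U s ∧
    X.scheme.evaluation U x h s = 0

variable (X) in
/-- The set `K_rat(X)` of all finite dimensional complex subspaces of the rational functions
on `X` whose restriction to every irreducible component is non-zero. -/
structure KRat where
  /-- the subspace of rational functions -/
  space : Submodule ℂ X.RatFun
  finiteDimensional : FiniteDimensional ℂ space
  restrict_ne_bot : ∀ η : X.GenericPoint,
    space.map (LinearMap.proj (R := ℂ) (φ := fun η : X.GenericPoint =>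
      X.scheme.presheaf.stalk η.1) η) ≠ ⊥

/-- The base locus of `L`: the set of points at which all functions of `L` vanish. -/
def KRat.baseLocus (L : X.KRat) : Set X.scheme :=
  {x | ∀ f ∈ L.space, RatFun.VanishesAt f x}

/-- The closed set `S` is admissible for `(X, L)`, where `n` is the dimension of `X`. The
irreducible divisors on `X` are the closures of the points `z` of codimension one, and a rational
function has a pole on such a divisor if it is not regular at its generic point `z`. (Divisors
inside the singular locus are in `S` anyway.) -/
structure KRat.IsAdmissible (n : ℕ) (L : X.KRat) (S : Set X.scheme) : Prop where
  isClosed : IsClosed S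
  singular_subset : (X.str.smoothLocus : Set X.scheme)ᶜ ⊆ S
  dim_lt : topologicalKrullDim S < n
  pole_subset : ∀ z : X.scheme, Order.coheight z = 1 →
    (∃ f ∈ L.space, ¬ RatFun.IsRegularAt f z) → closure {z} ⊆ S
  baseLocus_subset : L.baseLocus ⊆ S

/-- The closed set `S` is admissible for `X` and the finite collection `L i`, `i : Fin n`. -/
def IsAdmissible {n : ℕ} (L : Fin n → X.KRat) (S : Set X.scheme) : Prop :=
  IsClosed S ∧ (X.str.smoothLocus : Set X.scheme)ᶜ ⊆ S ∧ topologicalKrullDim S < n ∧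
    ∀ i, (L i).IsAdmissible n S

/-- The set of solutions in (the complex points, i.e. the closed points, of) `X \ S` of the
system `f 0 = ⋯ = f (n - 1) = 0`. -/
def solutions {n : ℕ} (S : Set X.scheme) (f : Fin n → X.RatFun) : Set X.scheme :=
  {x | x ∉ S ∧ IsClosed {x} ∧ ∀ i, RatFun.VanishesAt (f i) x}

/-- The numbers of roots in `X \ S` of those systems `f 0 = ⋯ = f (n - 1) = 0`, `f i ∈ L i`,
that have only finitely many solutions in `X \ S`. -/
def rootCounts {n : ℕ} (S : Set X.scheme) (L : Fin n → X.KRat) : Set ℕ :=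
  {k | ∃ f : Fin n → X.RatFun, (∀ i, f i ∈ (L i).space) ∧
    (solutions S f).Finite ∧ (solutions S f).ncard = k}

/-- The intersection index `[L 0, …, L (n - 1)]` on `X \ S`: the maximum of the numbers of
roots of the systems with finitely many solutions. -/
def indexOnCompl {n : ℕ} (S : Set X.scheme) (L : Fin n → X.KRat) : ℕ :=
  sSup (rootCounts S L)

open Classical in
/-- The birationally invariant intersection index `[L 0, …, L (n - 1)]` of `X`: the
intersection index on `X \ S`, for any choice of an admissible closed set `S`. -/
def intersectionIndex {n : ℕ} (L : Fin n → X.KRat) : ℕ :=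
  if h : ∃ S, IsAdmissible L S then indexOnCompl h.choose L else 0

end ComplexVariety

end

/-!
Fix an admissible set `S`. The open set `X \ S` is smooth, hence normal, and the functions of the
`L i` have no poles of codimension one on it; so they are regular there
(`exists_denominator_notMem_of_height_one`,
`ComplexVariety.Chart.exists_germ_eq`), and they have no base points there. Cover `X \ S` by
finitely many integral affine charts (`ComplexVariety.exists_systemAtlas`). The theorem is then a
statement about systems `f 0 = ⋯ = f (n - 1) = 0` of regular functions on these charts, and it
follows from three facts.

* *Bound* (`exists_bound_of_finite_solutions`): the solution sets of all systems are the fibres of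
  one morphism of finite type, the projection of the universal solution variety to the space of
  systems. By Zariski's main theorem this morphism is, near a point isolated in its fibre, an open
  part of a finite one; so the number of points of a finite fibre is bounded.
* *General position* (`exists_perturbation_finite`): given `f` and a nowhere dense closed set `T`,
  there is a `g` such that for all but finitely many `t` the system `f + t g` has only finitely many
  solutions, all of them off `T`. The components `g i` are chosen one after the other: since the
  `L i` have no base points, each equation `f i + X g i = 0` on the product of a chart with a line
  can be made to cut down the dimension of every component of the preceding solution set, and of its
  part over `T`, off the hyperplane `X = 0`.
* *Persistence* (`exists_solutions_of_perturbation`): given `K` isolated solutions of `f`, there is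
  a `t` outside a given finite set such that `f + t g` has at least `K` distinct solutions. On the
  product of `K` charts and a line, which has local dimension at least `K n + 1`, the solutions form
  a point of a set cut out by `K n` equations. By Krull's height theorem that set has positive
  dimension at the point, and since the solutions are isolated for `X = 0`, some component of it is
  not contained in `X = 0`. A general point of this component gives `K` solutions of some
  `f + t g`; they are distinct since the diagonal of the separated scheme `X` is closed.

The bound shows that the maximum exists. Combining general position and persistence
(`ComplexVariety.exists_perturbation`), every system with finitely many solutions off `S` can be
perturbed to a system with at least as many solutions, all off a larger admissible set, so that the
maximum does not depend on the admissible set. As any two admissible sets lie in a third one,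
this gives independence of all choices; symmetry and monotonicity follow by comparing both sides on
a common admissible set.
-/

universe u

/-! ### Regularity in codimension one -/

/-- A rational function without poles of codimension one is regular at a point where the variety is
normal. A maximal member `D g ≤ p` of the family of ideals of denominators that contain the one of
`f` is prime. Either `g` is integral over `A`, or `D g` is a minimal prime over a principal
ideal, hence of height one; both are excluded by the assumptions. -/
theorem exists_denominator_notMem_of_height_one {A F : Type*} [CommRing A] [IsDomain A]
    [IsNoetherianRing A] [Field F] [Algebra A F] [IsFractionRing A F]
    (p : Ideal A) [p.IsPrime]
    (hp : ∀ g : F, IsIntegral A g → ∃ s ∉ p, ∃ a : A, algebraMap A F s * g = algebraMap A F a)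
    (f : F) (hf : ∀ q : Ideal A, q.IsPrime → q ≤ p → q.height = 1 →
      ∃ s ∉ q, ∃ a : A, algebraMap A F s * f = algebraMap A F a) :
    ∃ s ∉ p, ∃ a : A, algebraMap A F s * f = algebraMap A F a := by
  classical
  -- the denominators of `g`
  let D : F → Ideal A := fun g =>
    { carrier := {s | ∃ a : A, algebraMap A F s * g = algebraMap A F a}
      add_mem' := by
        rintro s t ⟨a, ha⟩ ⟨b, hb⟩
        exact ⟨a + b, by rw [map_add, map_add, add_mul, ha, hb]⟩
      zero_mem' := ⟨0, by simp⟩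
      smul_mem' := by
        rintro c s ⟨a, ha⟩
        exact ⟨c * a, by rw [smul_eq_mul, map_mul, map_mul, mul_assoc, ha]⟩ }
  have hD (g : F) (s : A) : s ∈ D g ↔ ∃ a : A, algebraMap A F s * g = algebraMap A F a := Iff.rfl
  by_contra! hcon
  have hfp : D f ≤ p := fun s hs => by
    by_contra hsp
    obtain ⟨a, ha⟩ := hs
    exact hcon s hsp a ha
  obtain ⟨I, ⟨hIp, hfI, g, rfl⟩, hmax⟩ := set_has_maximal_iff_noetherian.mpr
    (inferInstance : IsNoetherian A A) {I : Ideal A | I ≤ p ∧ D f ≤ I ∧ ∃ g, I = D g}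
    ⟨D f, hfp, le_rfl, f, rfl⟩
  have hinj := IsFractionRing.injective A F
  have hmul (s : A) (t : A) : t ∈ D (algebraMap A F s * g) ↔ t * s ∈ D g := by
    simp only [hD, map_mul, mul_assoc]
  have hle (s : A) : D g ≤ D (algebraMap A F s * g) := fun t ht => by
    rw [hmul]; exact Ideal.mul_mem_right _ _ ht
  -- an element of the maximal `D g` is detected after multiplication by elements outside `p`
  have hout (s : A) (hs : s ∉ p) (t : A) (ht : t * s ∈ D g) : t ∈ D g := by
    by_contra htg
    by_cases hp' : D (algebraMap A F s * g) ≤ p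
    · refine hmax _ ⟨hp', hfI.trans (hle s), _, rfl⟩ (lt_of_le_of_ne (hle s) fun h => htg ?_)
      rw [h, hmul]; exact ht
    · obtain ⟨u, hu, hup⟩ := Set.not_subset.mp hp'
      have hu' : u * s ∈ D g := (hmul s u).mp hu
      exact (inferInstance : p.IsPrime).mul_notMem hup hs (hIp hu')
  have hprime : (D g).IsPrime := by
    refine ⟨fun h => ?_, fun {s t} hst => ?_⟩
    · exact (inferInstance : p.IsPrime).ne_top (top_le_iff.mp (h ▸ hIp))
    · by_contra! hcon'
      by_cases hp' : D (algebraMap A F t * g) ≤ p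
      · refine hmax _ ⟨hp', hfI.trans (hle t), _, rfl⟩
          (lt_of_le_of_ne (hle t) fun h => hcon'.1 ?_)
        rw [h, hmul]; exact hst
      · obtain ⟨u, hu, hup⟩ := Set.not_subset.mp hp'
        have hu' : u * t ∈ D g := (hmul t u).mp hu
        exact hcon'.2 (hout u hup t (by rwa [mul_comm]))
  -- `D g` has height one
  have hex : ∃ a ∈ D g, ∃ b ∉ D g, algebraMap A F a * g = algebraMap A F b := by
    by_contra! hall
    have hint : IsIntegral A g := by
      by_cases hbot : D g = ⊥
      · exfalso
        obtain ⟨a, s, rfl⟩ := IsLocalization.exists_mk'_eq (nonZeroDivisors A) g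
        have : (s : A) ∈ D (IsLocalization.mk' F a s) := ⟨a, by
          rw [mul_comm, IsLocalization.mk'_spec]⟩
        rw [hbot, Ideal.mem_bot] at this
        exact nonZeroDivisors.coe_ne_zero s this
      · obtain ⟨a₀, ha₀, ha₀'⟩ := Submodule.exists_mem_ne_zero_of_ne_bot hbot
        let l : A →ₗ[A] F := Algebra.linearMap A F
        have hFG : (Submodule.map l (D g)).FG :=
          Submodule.FG.map _ (IsNoetherian.noetherian (D g))
        refine isIntegral_of_smul_mem_submodule (M := F) (Submodule.map l (D g))
          ((Submodule.ne_bot_iff _).mpr ⟨algebraMap A F a₀, ⟨a₀, ha₀, rfl⟩, ?_⟩) hFG g ?_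
        · simpa using ha₀'
        · rintro _ ⟨a, ha, rfl⟩
          obtain ⟨b, hb⟩ := id ha
          refine ⟨b, ?_, ?_⟩
          · by_contra hbg
            exact hall a ha b hbg hb
          · simp [l, ← hb, mul_comm]
    obtain ⟨s, hs, a, ha⟩ := hp g hint
    exact hs (hIp ⟨a, ha⟩)
  obtain ⟨a, ha, b, hb, hab⟩ := hex
  have ha0 : a ≠ 0 := by
    rintro rfl
    apply hb
    have : b = 0 := hinj (by rw [← hab]; simp)
    rw [this]; exact zero_mem _
  have hmin : D g ∈ (Ideal.span {a}).minimalPrimes := by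
    refine ⟨⟨hprime, by simpa [Ideal.span_le] using ha⟩, ?_⟩
    rintro q ⟨hq, haq⟩ hqg c hc
    obtain ⟨d, hd⟩ := hc
    have : b * c = d * a := hinj (by
      rw [map_mul, map_mul, ← hab, ← hd]; ring)
    have hbc : b * c ∈ q := by
      rw [this]; exact Ideal.mul_mem_left _ _ (haq (Ideal.mem_span_singleton_self a))
    exact (hq.mem_or_mem hbc).resolve_left fun h => hb (hqg h)
  have h1 : (D g).height = 1 := by
    refine le_antisymm (Ideal.height_le_one_of_isPrincipal_of_mem_minimalPrimes _ _ hmin) ?_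
    rw [Order.one_le_iff_pos, pos_iff_ne_zero, Ne, Ideal.height_eq_zero_iff_eq_bot]
    intro h
    rw [h] at ha
    exact ha0 ha
  obtain ⟨s, hs, c, hc⟩ := hf (D g) hprime hIp h1
  exact hs (hfI ⟨c, hc⟩)

/-! ### Normality of smooth varieties -/

open TensorProduct in
/-- The reduced local rings of an étale algebra over a normal domain are normal domains. Integral
closure commutes with étale base change, so the local ring `O` is integrally closed in
`F = O ⊗ Frac P`. This ring is Artinian and reduced, and it has no nontrivial idempotents, because
these would lie in `O`; so it is a field, and the fraction field of `O`. -/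
theorem isDomain_and_isIntegrallyClosed_of_etale {P D : Type u} [CommRing P] [IsDomain P]
    [IsIntegrallyClosed P] [CommRing D] [Algebra P D] [Algebra.Etale P D]
    (q : Ideal D) [q.IsPrime] [_root_.IsReduced (Localization.AtPrime q)] :
    IsDomain (Localization.AtPrime q) ∧ IsIntegrallyClosed (Localization.AtPrime q) := by
  let O := Localization.AtPrime q
  let K := FractionRing P
  let F := O ⊗[P] K
  have hflat : Module.Flat P O := Module.Flat.trans P D O
  have hinj : Function.Injective (algebraMap O F) :=
    Algebra.TensorProduct.includeLeft_injective (S := O) (IsFractionRing.injective P K)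
  -- `O` is integrally closed in `F`
  have hbij : Function.Bijective (TensorProduct.toIntegralClosure P O K) := by
    refine TensorProduct.toIntegralClosure_bijective_of_tower (S := D)
      TensorProduct.toIntegralClosure_bijective_of_smooth
      (TensorProduct.toIntegralClosure_bijective_of_isLocalization q.primeCompl)
  have hint : ∀ y : F, IsIntegral O y → ∃ o : O, algebraMap O F o = y := by
    intro y hy
    obtain ⟨z, hz⟩ := hbij.2 ⟨y, hy⟩
    have hz' : (TensorProduct.toIntegralClosure P O K z : F) = y := congrArg Subtype.val hz
    rw [← hz']
    clear hz hz' hy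
    induction z with
    | zero => exact ⟨0, by simp⟩
    | add x y hx hy =>
      obtain ⟨a, ha⟩ := hx
      obtain ⟨b, hb⟩ := hy
      exact ⟨a + b, by rw [map_add, map_add, ha, hb]; rfl⟩
    | tmul o k =>
      have hk : (k : K) ∈ (⊥ : Subalgebra P K) := by
        rw [← IsIntegrallyClosed.integralClosure_eq_bot P K]; exact k.2
      obtain ⟨c, hc⟩ := Algebra.mem_bot.mp hk
      refine ⟨c • o, ?_⟩
      change (c • o) ⊗ₜ[P] (1 : K) = o ⊗ₜ[P] (k : K)
      rw [← hc, TensorProduct.smul_tmul, Algebra.algebraMap_eq_smul_one]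
  have hloc : IsLocalization (Algebra.algebraMapSubmonoid O (nonZeroDivisors P)) F := inferInstance
  have hred : _root_.IsReduced F :=
    isReduced_localizationPreserves (Algebra.algebraMapSubmonoid O (nonZeroDivisors P)) F
      (inferInstanceAs (_root_.IsReduced (Localization.AtPrime q)))
  have hqf : Algebra.QuasiFinite P O := .of_isLocalization (S := D) q.primeCompl
  have hart : IsArtinianRing F := by
    have : Module.Finite K (K ⊗[P] O) := .of_quasiFinite
    have : IsArtinianRing (K ⊗[P] O) := .of_finite K _
    exact (Algebra.TensorProduct.comm P K O).toRingEquiv.isArtinianRing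
  have hnt : Nontrivial F := hinj.nontrivial
  -- `y ^ n * b ^ n` is the idempotent that generates a power of the ideal of `y`
  have hunit : ∀ y : F, y ≠ 0 → IsUnit y := by
    intro y hy
    obtain ⟨n, b, hb⟩ := IsArtinian.exists_pow_succ_smul_dvd y (1 : F)
    simp only [smul_eq_mul, mul_one] at hb
    have hpow : ∀ m, y ^ n = y ^ (n + m) * b ^ m := by
      intro m
      induction m with
      | zero => simp
      | succ m ih =>
        calc y ^ n = y ^ n * y ^ m * b ^ m := by rw [← pow_add]; exact ih
          _ = (y ^ (n + 1) * b) * y ^ m * b ^ m := by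
            rw [show y ^ (n + 1) * b = y ^ n by simpa [pow_succ] using hb]
          _ = _ := by ring
    have hidem : (y ^ n * b ^ n) * (y ^ n * b ^ n) = y ^ n * b ^ n := by
      have := hpow n
      calc (y ^ n * b ^ n) * (y ^ n * b ^ n) = (y ^ (n + n) * b ^ n) * b ^ n := by ring
        _ = _ := by rw [← this]
    obtain ⟨o, ho⟩ := hint (y ^ n * b ^ n) ⟨Polynomial.X ^ 2 - Polynomial.X,
      Polynomial.monic_X_pow_sub (by simp), by
        simp only [Polynomial.eval₂_sub, Polynomial.eval₂_pow, Polynomial.eval₂_X]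
        rw [pow_two, hidem, sub_self]⟩
    have ho2 : o * (1 - o) = 0 := hinj (by
      rw [map_mul, map_sub, map_one, ho, map_zero, mul_sub, hidem]; simp)
    have hyn : y ^ n ≠ 0 := fun h => hy (IsReduced.eq_zero _ ⟨n, h⟩)
    rcases IsLocalRing.isUnit_or_isUnit_one_sub_self o with h | h
    · have : o = 1 := by
        have := (h.mul_right_eq_zero).mp ho2
        exact (sub_eq_zero.mp this).symm
      rw [this, map_one] at ho
      refine IsUnit.of_mul_eq_one (y ^ n * b * b ^ n) ?_
      calc y * (y ^ n * b * b ^ n) = (y ^ (n + 1) * b) * b ^ n := by ring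
        _ = 1 := by rw [hb, ← ho]
    · have : o = 0 := (h.mul_left_eq_zero).mp ho2
      rw [this, map_zero] at ho
      exfalso
      apply hyn
      calc y ^ n = y ^ (n + n) * b ^ n := hpow n
        _ = y ^ n * (y ^ n * b ^ n) := by ring
        _ = 0 := by rw [← ho, mul_zero]
  have hfield : IsField F := ⟨⟨0, 1, zero_ne_one⟩, mul_comm,
    fun {y} hy => (hunit y hy).exists_right_inv⟩
  let _ : Field F := hfield.toField
  have hdom : IsDomain O := hinj.isDomain
  have hfrac : IsFractionRing O F := by
    refine IsLocalization.of_le (Algebra.algebraMapSubmonoid O (nonZeroDivisors P))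
      (nonZeroDivisors O) ?_ ?_
    · intro x hx
      refine mem_nonZeroDivisors_of_ne_zero fun h => ?_
      have := IsLocalization.map_units F ⟨x, hx⟩
      simp [h] at this
    · intro x hx
      refine (isUnit_iff_ne_zero).mpr fun h =>
        nonZeroDivisors.ne_zero hx (hinj (by rw [h, map_zero]))
  exact ⟨hdom, (isIntegrallyClosed_iff F).mpr fun {y} hy => hint y hy⟩

/-- Near a smooth point, a variety is étale over an affine space. -/
theorem isDomain_and_isIntegrallyClosed_of_isSmoothAt {R A : Type u} [CommRing R] [IsDomain R]
    [UniqueFactorizationMonoid R] [CommRing A] [Algebra R A] [Algebra.FinitePresentation R A]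
    (p : Ideal A) [p.IsPrime] [Algebra.IsSmoothAt R p] [_root_.IsReduced A] :
    IsDomain (Localization.AtPrime p) ∧ IsIntegrallyClosed (Localization.AtPrime p) := by
  obtain ⟨f, hf, n, _, _, _⟩ :=
    Algebra.IsSmoothAt.exists_isStandardEtale_mvPolynomial (R := R) (p := p)
  let D := Localization.Away f
  have hdisj : Disjoint (Submonoid.powers f : Set A) p := by
    rw [Set.disjoint_left]
    rintro _ ⟨k, rfl⟩ hk
    exact hf (Ideal.IsPrime.mem_of_pow_mem ‹_› _ hk)
  let q : Ideal D := p.map (algebraMap A D)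
  have hq : q.IsPrime :=
    IsLocalization.isPrime_of_isPrime_disjoint (Submonoid.powers f) D p ‹_› hdisj
  have hqp : q.comap (algebraMap A D) = p :=
    IsLocalization.under_map_of_isPrime_disjoint (Submonoid.powers f) D ‹_› hdisj
  have := IsLocalization.isLocalization_isLocalization_atPrime_isLocalization
    (Submonoid.powers f) (Localization.AtPrime q) q
  have : IsLocalization.AtPrime (Localization.AtPrime q) p := by
    convert! this
    exact hqp.symm
  let e : Localization.AtPrime q ≃+* Localization.AtPrime p :=
    (IsLocalization.algEquiv p.primeCompl (Localization.AtPrime q)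
      (Localization.AtPrime p)).toRingEquiv
  obtain ⟨h1, h2⟩ := isDomain_and_isIntegrallyClosed_of_etale (P := MvPolynomial (Fin n) R) q
  exact ⟨e.symm.toMulEquiv.isDomain, .of_equiv e⟩

/-! ### Dimension of affine varieties -/

theorem height_eq_of_isMaximal_mvPolynomial {k : Type*} [Field k] (n : ℕ)
    (m : Ideal (MvPolynomial (Fin n) k)) [m.IsMaximal] : m.height = n := by
  induction n with
  | zero =>
    let e := MvPolynomial.isEmptyAlgEquiv k (Fin 0)
    have hf : IsField (MvPolynomial (Fin 0) k) :=
      MulEquiv.isField (Field.toIsField k) e.toMulEquiv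
    let _ := hf.toField
    have : m = ⊥ := (Ideal.eq_bot_or_top m).resolve_right Ideal.IsPrime.ne_top'
    rw [this, Ideal.height_bot]; rfl
  | succ n ih =>
    let e := (MvPolynomial.finSuccEquiv k n).toRingEquiv
    let M : Ideal (Polynomial (MvPolynomial (Fin n) k)) := m.comap e.symm
    have hM : M.IsMaximal := Ideal.comap_isMaximal_of_surjective _ e.symm.surjective
    have h1 : M.height = m.height := RingEquiv.height_comap e.symm m
    let p := M.comap (Polynomial.C : MvPolynomial (Fin n) k →+* _)
    have hp : p.IsMaximal := Polynomial.isMaximal_comap_C_of_isJacobsonRing M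
    have : M.LiesOver p := ⟨rfl⟩
    rw [← h1, Polynomial.height_eq_height_add_one p M, ih p]
    push_cast; rfl

/-- The dimension of an integral affine variety is its local dimension at each closed point and the
transcendence degree of its coordinate ring, by Noether normalization and going down. -/
theorem exists_height_eq_ringKrullDim_trdeg {k A : Type u} [Field k] [CommRing A] [IsDomain A]
    [Algebra k A] [Algebra.FiniteType k A] :
    ∃ s : ℕ, ringKrullDim A = s ∧ (∀ m : Ideal A, m.IsMaximal → m.height = s) ∧
      Algebra.trdeg k A = s := by
  obtain ⟨s, g, hg, hint⟩ := exists_integral_inj_algHom_of_fg k A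
  let P := MvPolynomial (Fin s) k
  algebraize [g.toRingHom]
  have : FaithfulSMul P A := (faithfulSMul_iff_algebraMap_injective P A).mpr hg
  have : Algebra.IsIntegral P A := ⟨hint⟩
  have : IsScalarTower k P A := IsScalarTower.of_algebraMap_eq fun x => (g.commutes x).symm
  have : IsNoetherianRing A := Algebra.FiniteType.isNoetherianRing k A
  have hm : ∀ m : Ideal A, m.IsMaximal → m.height = s := by
    intro m hm
    have : (m.under P).IsMaximal := Ideal.isMaximal_comap_of_isIntegral_of_isMaximal m
    have h := Ideal.height_eq_height_add_of_liesOver_of_hasGoingDown (m.under P) m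
    refine le_antisymm ?_ ?_
    · rw [← height_eq_of_isMaximal_mvPolynomial s (m.under P)]
      have hmono : StrictMono (PrimeSpectrum.comap (algebraMap P A)) := fun I J hIJ =>
        Ideal.IsIntegral.comap_lt_comap (R := P) hIJ
      have := Order.height_le_height_apply_of_strictMono _ hmono ⟨m, hm.isPrime⟩
      rwa [← PrimeSpectrum.height_eq_orderHeight, ← PrimeSpectrum.height_eq_orderHeight] at this
    · rw [h, height_eq_of_isMaximal_mvPolynomial]
      exact le_self_add
  refine ⟨s, ?_, hm, ?_⟩
  · refine le_antisymm ?_ ?_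
    · rw [ringKrullDim_le_iff_isMaximal_height_le]
      intro I hI
      rw [hm I hI]; rfl
    · obtain ⟨m, hmm⟩ := Ideal.exists_maximal A
      have := Ideal.height_le_ringKrullDim_of_ne_top hmm.ne_top
      rwa [hm m hmm] at this
  · have h := trdeg_add_eq k P (A := A)
    rw [trdeg_eq_zero (R := P) (A := A), add_zero, MvPolynomial.trdeg_of_isDomain] at h
    simpa using h.symm

/-! ### Bounds for the number of solutions -/

/-- The Nullstellensatz, in terms of `k`-points. -/
theorem exists_algHom_of_notMem {k A : Type*} [Field k] [IsAlgClosed k] [CommRing A] [Algebra k A]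
    [Algebra.FiniteType k A] (q : Ideal A) [hq : q.IsPrime] {b : A} (hb : b ∉ q) :
    ∃ φ : A →ₐ[k] k, q ≤ RingHom.ker φ ∧ φ b ≠ 0 := by
  have : IsJacobsonRing A := isJacobsonRing_of_finiteType (A := k)
  have hj : q.jacobson = q := IsJacobsonRing.out' q hq.isRadical
  rw [← hj, Ideal.jacobson, Submodule.mem_sInf] at hb
  push Not at hb
  obtain ⟨m, ⟨hqm, hm⟩, hbm⟩ := hb
  let _ := Ideal.Quotient.field m
  have : Module.Finite k (A ⧸ m) := finite_of_finite_type_of_isJacobsonRing k (A ⧸ m)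
  have hbij := IsAlgClosed.algebraMap_bijective_of_isIntegral (k := k) (K := A ⧸ m)
  let e : k ≃ₐ[k] A ⧸ m := AlgEquiv.ofBijective (Algebra.ofId k (A ⧸ m)) hbij
  refine ⟨e.symm.toAlgHom.comp (Ideal.Quotient.mkₐ k m), fun x hx => ?_, fun h => hbm ?_⟩
  · have : Ideal.Quotient.mk m x = 0 := Ideal.Quotient.eq_zero_iff_mem.mpr (hqm hx)
    simp [RingHom.mem_ker, this]
  · refine Ideal.Quotient.eq_zero_iff_mem.mp (e.symm.injective ?_)
    rw [map_zero]
    exact h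

/-- An irreducible closed set that is not contained in the closed set defined by `T`, and has only
finitely many points off it, is a point. -/
theorem exists_ker_eq_of_finite {k A : Type*} [Field k] [IsAlgClosed k] [CommRing A] [Algebra k A]
    [Algebra.FiniteType k A] (q T : Ideal A) [hq : q.IsPrime] (hT : ¬ T ≤ q)
    (hfin : {φ : A →ₐ[k] k | q ≤ RingHom.ker φ ∧ ¬ T ≤ RingHom.ker φ}.Finite) :
    ∃ φ : A →ₐ[k] k, RingHom.ker φ = q := by
  by_contra! hcon
  have hex : ∀ φ : {φ : A →ₐ[k] k | q ≤ RingHom.ker φ ∧ ¬ T ≤ RingHom.ker φ},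
      ∃ b, φ.1 b = 0 ∧ b ∉ q := by
    rintro ⟨φ, h1, -⟩
    by_contra! h
    exact hcon φ (le_antisymm (fun b hb => h b hb) h1)
  choose b hb hbq using hex
  obtain ⟨τ, hτ, hτq⟩ := Set.not_subset.mp hT
  have _ := hfin.fintype
  have hprod : τ * ∏ φ, b φ ∉ q := hq.mul_notMem hτq fun h => by
    obtain ⟨φ, -, h⟩ := (hq.prod_mem_iff).mp h
    exact hbq φ h
  obtain ⟨φ, hφq, hφ⟩ := exists_algHom_of_notMem (k := k) q hprod
  rw [map_mul] at hφ
  have hφT : ¬ T ≤ RingHom.ker φ := fun h => left_ne_zero_of_mul hφ (h hτ)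
  refine right_ne_zero_of_mul hφ ?_
  rw [map_prod]
  exact Finset.prod_eq_zero (Finset.mem_univ ⟨φ, hφq, hφT⟩) (hb ⟨φ, hφq, hφT⟩)

/-- A finite morphism whose algebra is spanned by `d` elements has at most `d` points over each
point, because distinct homomorphisms to a field are linearly independent. -/
theorem encard_algHom_le_of_span_eq_top {k R S : Type*} [Field k] [CommRing R] [CommRing S]
    [Algebra k R] [Algebra k S] [Algebra R S] (t : Finset S)
    (ht : Submodule.span R (t : Set S) = ⊤) (e : R →+* k) :
    {ψ : S →+* k | ψ.comp (algebraMap R S) = e}.encard ≤ t.card := by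
  classical
  let F : {ψ : S →+* k | ψ.comp (algebraMap R S) = e} → (t → k) := fun ψ x => ψ.1 x
  have hlin : LinearIndependent k F := by
    have h0 := (linearIndependent_monoidHom S k).comp
      (fun ψ : {ψ : S →+* k | ψ.comp (algebraMap R S) = e} => (ψ.1 : S →* k))
      (fun a b h => Subtype.ext (RingHom.ext fun x => DFunLike.congr_fun h x))
    rw [linearIndependent_iff'] at h0 ⊢
    intro s g hg
    refine h0 s g ?_
    ext x
    have hx : x ∈ Submodule.span R (t : Set S) := ht ▸ Submodule.mem_top
    induction hx using Submodule.span_induction with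
    | mem x hx => simpa [F] using congrFun hg ⟨x, hx⟩
    | zero => simp
    | add x y _ _ hx hy =>
      simp only [Finset.sum_apply, Pi.smul_apply, Function.comp_apply, Pi.zero_apply,
        smul_eq_mul, MonoidHom.coe_coe, map_add, mul_add, Finset.sum_add_distrib] at hx hy ⊢
      rw [hx, hy, add_zero]
    | smul a x _ hx =>
      simp only [Finset.sum_apply, Pi.smul_apply, Function.comp_apply, Pi.zero_apply,
        smul_eq_mul, MonoidHom.coe_coe] at hx ⊢
      have : ∀ ψ : {ψ : S →+* k | ψ.comp (algebraMap R S) = e}, ψ.1 (a • x) = e a * ψ.1 x := by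
        intro ψ
        rw [Algebra.smul_def, map_mul]
        exact congrArg (· * ψ.1 x) (DFunLike.congr_fun ψ.2 a)
      simp only [this]
      calc ∑ i ∈ s, g i * (e a * i.1 x) = e a * ∑ i ∈ s, g i * i.1 x := by
            rw [Finset.mul_sum]; exact Finset.sum_congr rfl fun i _ => by ring
        _ = 0 := by rw [hx, mul_zero]
  have hfin : Finite {ψ : S →+* k | ψ.comp (algebraMap R S) = e} := hlin.finite
  have _ := Fintype.ofFinite {ψ : S →+* k | ψ.comp (algebraMap R S) = e}
  have h := hlin.fintype_card_le_finrank
  rw [Module.finrank_fintype_fun_eq_card, Fintype.card_coe] at h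
  rw [Set.encard_eq_coe_toFinset_card, Set.toFinset_card]
  exact_mod_cast h

/-- The cardinality of the finite fibres of a morphism of finite type is bounded. The points
of finite fibres lie in the open set where the morphism is quasi-finite; by Zariski's main theorem
and quasi-compactness, finitely many open parts of finite morphisms cover this set. -/
theorem exists_bound_of_finite_fibers {k R S : Type*} [Field k] [IsAlgClosed k] [CommRing R]
    [CommRing S] [Algebra k R] [Algebra k S] [Algebra R S] [IsScalarTower k R S]
    [Algebra.FiniteType k R] [Algebra.FiniteType R S] :
    ∃ N : ℕ, ∀ e : R →ₐ[k] k, {ψ : S →ₐ[k] k | ∀ r, ψ (algebraMap R S r) = e r}.Finite →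
      {ψ : S →ₐ[k] k | ∀ r, ψ (algebraMap R S r) = e r}.ncard ≤ N := by
  classical
  have hprime : ∀ ψ : S →ₐ[k] k, (RingHom.ker ψ).IsPrime := fun ψ => RingHom.ker_isPrime _
  have hprime' : ∀ ψ : R →ₐ[k] k, (RingHom.ker ψ).IsPrime := fun ψ => RingHom.ker_isPrime _
  have : Algebra.FiniteType k S := Algebra.FiniteType.trans (S := R) ‹_› ‹_›
  have : IsNoetherianRing S := Algebra.FiniteType.isNoetherianRing k S
  have : IsJacobsonRing S := isJacobsonRing_of_finiteType (A := k)
  -- near a point isolated in its fibre the morphism is an open part of a finite one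
  have hloc : ∀ Q : {Q : PrimeSpectrum S // Algebra.QuasiFiniteAt R Q.asIdeal},
      ∃ r : S, r ∉ Q.1.asIdeal ∧ ∃ N : ℕ, ∀ e : R →ₐ[k] k,
        {ψ : S →ₐ[k] k | (∀ x, ψ (algebraMap R S x) = e x) ∧ ψ r ≠ 0}.encard ≤ N := by
    rintro ⟨Q, hQ⟩
    obtain ⟨S', hS', r, hr, hbij⟩ :=
      Algebra.QuasiFiniteAt.exists_fg_and_exists_notMem_and_awayMap_bijective (R := R) Q.asIdeal
    obtain ⟨t, ht⟩ : (⊤ : Submodule R S').FG := (Submodule.fg_top _).mpr hS'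
    refine ⟨r, hr, t.card, fun e => ?_⟩
    refine le_trans ?_ (encard_algHom_le_of_span_eq_top (k := k) t ht e.toRingHom)
    refine Set.encard_le_encard_of_injOn (f := fun ψ => ψ.toRingHom.comp S'.val.toRingHom) ?_ ?_
    · rintro ψ ⟨hψ, -⟩
      exact RingHom.ext fun x => hψ x
    · rintro ψ ⟨hψ, hψr⟩ ψ' ⟨hψ', hψr'⟩ h
      have h' : ∀ x : S', ψ x = ψ' x := fun x => DFunLike.congr_fun h x
      ext x
      obtain ⟨n, y, hy⟩ : ∃ n : ℕ, ∃ y : S', (r : S) ^ n * x = y := by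
        obtain ⟨z, hz⟩ := hbij.2 (algebraMap S _ x)
        obtain ⟨⟨y, ⟨_, m, rfl⟩⟩, hy⟩ := IsLocalization.surj (Submonoid.powers r) z
        have hy' := congrArg (Localization.awayMap S'.val.toRingHom r) hy
        rw [map_mul, hz] at hy'
        simp only [Localization.awayMap, IsLocalization.Away.map, IsLocalization.map_eq] at hy'
        rw [← map_mul] at hy'
        obtain ⟨⟨_, l, rfl⟩, hc⟩ := IsLocalization.exists_of_eq
          (M := Submonoid.powers (S'.val.toRingHom r)) hy'
        refine ⟨l + m, r ^ l * y, ?_⟩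
        simp only [map_pow] at hc
        rw [pow_add, mul_assoc, mul_comm _ x]
        simpa using hc
      have h1 := h' y
      rw [← hy, map_mul, map_mul, map_pow, map_pow, h' r] at h1
      exact mul_left_cancel₀ (pow_ne_zero _ hψr') h1
  choose r hr N hN using hloc
  -- finitely many of these open sets cover
  obtain ⟨T, hT⟩ : ∃ T : Finset {Q : PrimeSpectrum S // Algebra.QuasiFiniteAt R Q.asIdeal},
      ∀ Q : {Q : PrimeSpectrum S // Algebra.QuasiFiniteAt R Q.asIdeal},
        ∃ Q' ∈ T, r Q' ∉ Q.1.asIdeal := by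
    have hc := TopologicalSpace.NoetherianSpace.isCompact
      (Set.range (Subtype.val : {Q : PrimeSpectrum S // Algebra.QuasiFiniteAt R Q.asIdeal} → _))
    obtain ⟨T, hT⟩ := hc.elim_finite_subcover (fun Q => (PrimeSpectrum.basicOpen (r Q) : Set _))
      (fun Q => PrimeSpectrum.isOpen_basicOpen) (by
        rintro _ ⟨Q, rfl⟩
        exact Set.mem_iUnion.mpr ⟨Q, hr Q⟩)
    refine ⟨T, fun Q => ?_⟩
    obtain ⟨Q', hQ'⟩ := Set.mem_iUnion.mp (hT ⟨Q, rfl⟩)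
    obtain ⟨hQ', h⟩ := Set.mem_iUnion.mp hQ'
    exact ⟨Q', hQ', h⟩
  refine ⟨∑ Q ∈ T, N Q, fun e hfin => ?_⟩
  -- the points of a finite fibre are isolated
  have hqf : ∀ ψ : S →ₐ[k] k, (∀ x, ψ (algebraMap R S x) = e x) →
      Algebra.QuasiFiniteAt R (RingHom.ker ψ) := by
    intro ψ hψ
    have hcomap : (⟨RingHom.ker ψ, inferInstance⟩ : PrimeSpectrum S).comap (algebraMap R S) =
        ⟨RingHom.ker e, inferInstance⟩ := by
      ext x
      simp [RingHom.mem_ker, hψ]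
    have hker : ∀ Q : PrimeSpectrum S, Q.comap (algebraMap R S) = ⟨RingHom.ker e, inferInstance⟩ →
        ∃ φ : S →ₐ[k] k, (∀ x, φ (algebraMap R S x) = e x) ∧ RingHom.ker φ = Q.asIdeal := by
      intro Q hQ
      have hover : ∀ φ : S →ₐ[k] k, Q.asIdeal ≤ RingHom.ker φ →
          ∀ x, φ (algebraMap R S x) = e x := by
        intro φ hφ x
        have hx : x - algebraMap k R (e x) ∈ RingHom.ker e := by simp [RingHom.mem_ker]
        have hx' : x - algebraMap k R (e x) ∈ (Q.comap (algebraMap R S)).asIdeal := by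
          rw [hQ]; exact hx
        have := hφ hx'
        rw [RingHom.mem_ker, map_sub, map_sub, ← IsScalarTower.algebraMap_apply, AlgHom.commutes,
          sub_eq_zero] at this
        simpa using this
      obtain ⟨φ, hφ⟩ := exists_ker_eq_of_finite (k := k) Q.asIdeal ⊤
        (fun h => Q.2.ne_top (top_le_iff.mp h)) (hfin.subset fun φ hφ => hover φ hφ.1)
      exact ⟨φ, hover φ hφ.ge, hφ⟩
    have := (Algebra.quasiFiniteAt_iff_isOpen_singleton_fiber (R := R)
      (⟨RingHom.ker ψ, inferInstance⟩ : PrimeSpectrum S)).mpr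
    refine this ?_
    let s := PrimeSpectrum.comap (algebraMap R S) ⁻¹'
      {(⟨RingHom.ker ψ, inferInstance⟩ : PrimeSpectrum S).comap (algebraMap R S)}
    have hs : s.Finite := by
      refine (hfin.image fun φ => (⟨RingHom.ker φ, inferInstance⟩ : PrimeSpectrum S)).subset ?_
      intro Q hQ
      obtain ⟨φ, h1, h2⟩ := hker Q (Eq.trans hQ hcomap)
      exact ⟨φ, h1, PrimeSpectrum.ext h2⟩
    have : Finite s := hs
    have : T1Space s := by
      refine ⟨fun Q => ?_⟩
      obtain ⟨φ, h1, h2⟩ := hker Q.1 (Eq.trans Q.2 hcomap)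
      have hmax : Q.1.asIdeal.IsMaximal := by
        rw [← h2]
        exact RingHom.ker_isMaximal_of_surjective φ fun c => ⟨algebraMap k S c, by simp⟩
      have := ((PrimeSpectrum.isClosed_singleton_iff_isMaximal Q.1).mpr hmax).preimage
        (continuous_subtype_val (p := (· ∈ s)))
      convert! this
      ext x; simp [Subtype.ext_iff]
    have : DiscreteTopology s := inferInstance
    exact isOpen_discrete (α := s) _
  have hsub : {ψ : S →ₐ[k] k | ∀ r, ψ (algebraMap R S r) = e r} ⊆
      ⋃ Q ∈ T, {ψ : S →ₐ[k] k | (∀ x, ψ (algebraMap R S x) = e x) ∧ ψ (r Q) ≠ 0} := by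
    intro ψ hψ
    obtain ⟨Q', hQ', h⟩ := hT ⟨⟨RingHom.ker ψ, inferInstance⟩, hqf ψ hψ⟩
    exact Set.mem_biUnion hQ' ⟨hψ, h⟩
  have hle : ∀ T' : Finset {Q : PrimeSpectrum S // Algebra.QuasiFiniteAt R Q.asIdeal},
      (⋃ Q ∈ T', {ψ : S →ₐ[k] k | (∀ x, ψ (algebraMap R S x) = e x) ∧ ψ (r Q) ≠ 0}).encard ≤
        (∑ Q ∈ T', N Q : ℕ) := by
    intro T'
    induction T' using Finset.induction_on with
    | empty => simp
    | insert a s ha ih =>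
      rw [Finset.set_biUnion_insert, Finset.sum_insert ha]
      push_cast
      exact (Set.encard_union_le _ _).trans (add_le_add (hN a e) (by exact_mod_cast ih))
  have := (Set.encard_le_encard hsub).trans (hle T)
  rw [← hfin.cast_ncard_eq] at this
  exact_mod_cast this

open TensorProduct in
/-- The number of solutions of a system with finitely many solutions is bounded: the solution sets
are the fibres of the universal system, whose coefficients are the variables `X ⟨i, j⟩`. -/
theorem exists_bound_of_finite_solutions {k A : Type*} [Field k] [IsAlgClosed k] [CommRing A]
    [Algebra k A] [Algebra.FiniteType k A] {n : ℕ} (E : Fin n → Type*)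
    [∀ i, AddCommGroup (E i)] [∀ i, Module k (E i)] [∀ i, FiniteDimensional k (E i)]
    (ρ : ∀ i, E i →ₗ[k] A) :
    ∃ N : ℕ, ∀ f : ∀ i, E i, {φ : A →ₐ[k] k | ∀ i, φ (ρ i (f i)) = 0}.Finite →
      {φ : A →ₐ[k] k | ∀ i, φ (ρ i (f i)) = 0}.ncard ≤ N := by
  -- the variables are the coordinates of a system with respect to bases `b i`
  let σ := Σ i : Fin n, Fin (Module.finrank k (E i))
  let b : ∀ i, Module.Basis (Fin (Module.finrank k (E i))) k (E i) := fun i =>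
    Module.finBasis k (E i)
  let R := MvPolynomial σ k
  let I : Ideal (R ⊗[k] A) := Ideal.span (Set.range fun i : Fin n =>
    ∑ j, (MvPolynomial.X ⟨i, j⟩ : R) ⊗ₜ[k] ρ i (b i j))
  let S := (R ⊗[k] A) ⧸ I
  obtain ⟨N, hN⟩ := exists_bound_of_finite_fibers (k := k) (R := R) (S := S)
  refine ⟨N, fun f hfin => ?_⟩
  -- the coordinates of `f`
  let e : R →ₐ[k] k := MvPolynomial.aeval fun s => (b s.1).repr (f s.1) s.2
  have he : ∀ s, e (MvPolynomial.X s) = (b s.1).repr (f s.1) s.2 := fun s =>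
    MvPolynomial.aeval_X _ _
  let res : (S →ₐ[k] k) → (A →ₐ[k] k) := fun ψ =>
    (ψ.comp (Ideal.Quotient.mkₐ k I)).comp Algebra.TensorProduct.includeRight
  have hsum (χ : R ⊗[k] A →ₐ[k] k) (hχ : ∀ r : R, χ (r ⊗ₜ 1) = e r) (i : Fin n) :
      χ (∑ j, (MvPolynomial.X ⟨i, j⟩ : R) ⊗ₜ[k] ρ i (b i j)) =
        χ ((1 : R) ⊗ₜ ρ i (f i)) := by
    conv_rhs => rw [← (b i).sum_repr (f i)]
    rw [map_sum, map_sum, TensorProduct.tmul_sum, map_sum]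
    refine Finset.sum_congr rfl fun j _ => ?_
    have : (MvPolynomial.X ⟨i, j⟩ : R) ⊗ₜ[k] ρ i (b i j) =
        ((MvPolynomial.X ⟨i, j⟩ : R) ⊗ₜ[k] (1 : A)) * ((1 : R) ⊗ₜ[k] ρ i (b i j)) := by
      simp
    rw [this, map_mul, hχ, he, map_smul, TensorProduct.tmul_smul, map_smul, smul_eq_mul]
  let fib : Set (S →ₐ[k] k) := {ψ | ∀ r : R, ψ (Ideal.Quotient.mk I (r ⊗ₜ 1)) = e r}
  have himage : {φ : A →ₐ[k] k | ∀ i, φ (ρ i (f i)) = 0} =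
      res '' fib := by
    ext φ
    constructor
    · intro hφ
      let χ : R ⊗[k] A →ₐ[k] k := Algebra.TensorProduct.lift e φ fun _ _ => .all _ _
      have hχI : ∀ x ∈ I, χ x = 0 := by
        intro x hx
        have : I ≤ RingHom.ker χ := by
          refine Ideal.span_le.mpr ?_
          rintro _ ⟨i, rfl⟩
          rw [SetLike.mem_coe, RingHom.mem_ker, hsum χ (fun r => by simp [χ])]
          simpa [χ] using hφ i
        exact this hx
      refine ⟨Ideal.Quotient.liftₐ I χ hχI, fun r => ?_, ?_⟩
      · change χ (r ⊗ₜ 1) = e r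
        simp [χ]
      · ext x
        change χ (1 ⊗ₜ x) = φ x
        simp [χ]
    · rintro ⟨ψ, hψ, rfl⟩ i
      have := hsum (ψ.comp (Ideal.Quotient.mkₐ k I)) hψ i
      change (ψ.comp (Ideal.Quotient.mkₐ k I)) ((1 : R) ⊗ₜ ρ i (f i)) = 0
      rw [← this]
      have h0 : Ideal.Quotient.mk I (∑ j, (MvPolynomial.X ⟨i, j⟩ : R) ⊗ₜ[k] ρ i (b i j)) = 0 :=
        Ideal.Quotient.eq_zero_iff_mem.mpr (Ideal.subset_span ⟨i, rfl⟩)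
      rw [AlgHom.comp_apply, Ideal.Quotient.mkₐ_eq_mk, h0, map_zero]
  have hinj : Set.InjOn res fib := by
    intro ψ hψ ψ' hψ' h
    refine Ideal.Quotient.algHom_ext k (Algebra.TensorProduct.ext ?_ h)
    ext r
    exact (hψ _).trans (hψ' _).symm
  have hfin' : fib.Finite :=
    Set.Finite.of_finite_image (himage ▸ hfin) hinj
  rw [himage]
  exact (Set.ncard_image_le hfin').trans (hN e hfin')

/-! ### Perturbing a system into general position -/

section
open Polynomial

/-- Given finitely many irreducible subvarieties of the products of the `A c` with a line, none of
them in the hyperplane `X = 0` or in the base locus of `V`, some function `f + X g` vanishes on none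
of them. -/
theorem exists_forall_notMem_prime {k V κ : Type*} [Field k] [Infinite k] [AddCommGroup V]
    [Module k V] (A : κ → Type*) [∀ c, CommRing (A c)] [∀ c, Algebra k (A c)]
    (ρ : ∀ c, V →ₗ[k] A c) (Q : Set (Σ c, PrimeSpectrum (A c)[X])) (hQ : Q.Finite)
    (hX : ∀ q ∈ Q, X ∉ q.2.asIdeal) (hρ : ∀ q ∈ Q, ∃ g, C (ρ q.1 g) ∉ q.2.asIdeal) (f : V) :
    ∃ g : V, ∀ q ∈ Q, C (ρ q.1 f) + X * C (ρ q.1 g) ∉ q.2.asIdeal := by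
  classical
  -- a vector outside finitely many proper subspaces
  obtain ⟨g₀, hg₀⟩ : ∃ g₀ : V, ∀ q ∈ Q, C (ρ q.1 g₀) ∉ q.2.asIdeal := by
    let W : (Σ c, PrimeSpectrum (A c)[X]) → Submodule k V := fun q =>
      { carrier := {g | C (ρ q.1 g) ∈ q.2.asIdeal}
        add_mem' := fun {a b} ha hb => by
          simp only [Set.mem_ofPred_eq, map_add]
          exact add_mem ha hb
        zero_mem' := by simp
        smul_mem' := fun c x hx => by
          simp only [Set.mem_ofPred_eq, map_smul, Algebra.smul_def, map_mul]
          exact Ideal.mul_mem_left _ _ hx }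
    have h := Subspace.biUnion_ne_univ_of_top_notMem (k := k) (E := V)
      (s := (hQ.image W).toFinset) (by
        rw [Set.Finite.mem_toFinset]
        rintro ⟨q, hq, h⟩
        obtain ⟨g, hg⟩ := hρ q hq
        exact hg (h ▸ Submodule.mem_top : g ∈ W q))
    obtain ⟨g₀, hg₀⟩ := (Set.ne_univ_iff_exists_notMem _).mp h
    refine ⟨g₀, fun q hq hmem => hg₀ ?_⟩
    exact Set.mem_biUnion (x := W q)
      (by rw [Finset.mem_coe, Set.Finite.mem_toFinset]; exact Set.mem_image_of_mem W hq) hmem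
  -- a suitable multiple of it works
  have hsub : ∀ q ∈ Q, {s : k | C (ρ q.1 f) + X * C (ρ q.1 (s • g₀)) ∈
      q.2.asIdeal}.Subsingleton := by
    intro q hq s hs t ht
    by_contra hst
    have h1 := q.2.asIdeal.sub_mem hs ht
    have h2 : C (ρ q.1 f) + X * C (ρ q.1 (s • g₀)) - (C (ρ q.1 f) + X * C (ρ q.1 (t • g₀))) =
        X * (C (algebraMap k (A q.1) (s - t)) * C (ρ q.1 g₀)) := by
      rw [← C_mul, ← Algebra.smul_def, (ρ q.1).map_smul, (ρ q.1).map_smul, sub_smul, C_sub]; ring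
    rw [h2] at h1
    have h3 := (q.2.2.mem_or_mem h1).resolve_left (hX q hq)
    refine hg₀ q hq ((q.2.2.mem_or_mem h3).resolve_left fun h => q.2.2.ne_top ?_)
    refine Ideal.eq_top_of_isUnit_mem _ h ?_
    exact ((sub_ne_zero.mpr hst).isUnit.map (algebraMap k (A q.1))).map C
  have hfin : (⋃ q ∈ Q, {s : k | C (ρ q.1 f) + X * C (ρ q.1 (s • g₀)) ∈ q.2.asIdeal}).Finite :=
    hQ.biUnion fun q hq => (hsub q hq).finite
  obtain ⟨s, hs⟩ := hfin.infinite_compl.nonempty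
  exact ⟨s • g₀, fun q hq h => hs (Set.mem_biUnion hq h)⟩

section
variable {k κ : Type*} [Field k] [IsAlgClosed k] [Finite κ] {n : ℕ}
    (A : κ → Type*) [∀ c, CommRing (A c)] [∀ c, IsDomain (A c)] [∀ c, Algebra k (A c)]
    [∀ c, Algebra.FiniteType k (A c)] (E : Fin n → Type*)
    [∀ i, AddCommGroup (E i)] [∀ i, Module k (E i)]
    (ρ : ∀ c i, E i →ₗ[k] A c)

/-- After the choice of `g i` for `i < m`, the solution set on the product with a line has dimension
at most `n + 1 - m` off `X = 0`, and its part over `T` has dimension at most `n - m`. The dimension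
of the closed set of a prime ideal is its coheight. -/
theorem exists_perturbation_coheight (hdim : ∀ c, ringKrullDim (A c) ≤ n)
    (hρ : ∀ c i (φ : A c →ₐ[k] k), ∃ g, φ (ρ c i g) ≠ 0) (T : ∀ c, Ideal (A c))
    (hT : ∀ c, T c ≠ ⊥) (f : ∀ i, E i) (m : ℕ) (hm : m ≤ n) :
    ∃ g : ∀ i, E i, ∀ c (q : PrimeSpectrum (A c)[X]), X ∉ q.asIdeal →
      (∀ i : Fin n, i.1 < m → C (ρ c i (f i)) + X * C (ρ c i (g i)) ∈ q.asIdeal) →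
      Order.coheight q + m ≤ n + 1 ∧
        ((T c).map C ≤ q.asIdeal → Order.coheight q + 1 + m ≤ n + 1) := by
  classical
  have _ : ∀ c, IsNoetherianRing (A c) := fun c => Algebra.FiniteType.isNoetherianRing k (A c)
  induction m with
  | zero =>
    refine ⟨0, fun c q hX _ => ?_⟩
    have hbot : Order.coheight (⊥ : PrimeSpectrum (A c)[X]) ≤ n + 1 := by
      have h1 : ringKrullDim (A c)[X] ≤ (n + 1 : ℕ) := by
        rw [Polynomial.ringKrullDim_of_isNoetherianRing]
        push_cast
        gcongr
        exact hdim c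
      have h2 := (Order.coheight_le_krullDim (⊥ : PrimeSpectrum (A c)[X])).trans h1
      exact_mod_cast h2
    refine ⟨?_, fun hTq => ?_⟩
    · simpa using (Order.coheight_anti (bot_le : ⊥ ≤ q)).trans hbot
    · have hlt : ⊥ < q := by
        refine bot_lt_iff_ne_bot.mpr fun h => hT c ?_
        rw [h] at hTq
        have : (T c).map C = ⊥ := le_bot_iff.mp hTq
        exact (Ideal.map_eq_bot_iff_of_injective C_injective).mp this
      simpa using (Order.coheight_add_one_le hlt).trans hbot
  | succ m ih =>
    obtain ⟨g, hg⟩ := ih (by omega)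
    let im : Fin n := ⟨m, hm⟩
    let F : ∀ c, Fin n → (A c)[X] := fun c i => C (ρ c i (f i)) + X * C (ρ c i (g i))
    let I : ∀ c, Ideal (A c)[X] := fun c => Ideal.span (F c '' {i | i.1 < m})
    let Q : Set (Σ c, PrimeSpectrum (A c)[X]) := {q | X ∉ q.2.asIdeal ∧
      (q.2.asIdeal ∈ (I q.1).minimalPrimes ∨
        q.2.asIdeal ∈ (I q.1 ⊔ (T q.1).map C).minimalPrimes)}
    have hQ : Q.Finite := by
      have : ∀ c, {q : PrimeSpectrum (A c)[X] | q.asIdeal ∈ (I c).minimalPrimes ∪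
          (I c ⊔ (T c).map C).minimalPrimes}.Finite := fun c =>
        Set.Finite.preimage (fun _ _ _ _ h => PrimeSpectrum.ext h)
          ((Ideal.finite_minimalPrimes_of_isNoetherianRing _ _).union
            (Ideal.finite_minimalPrimes_of_isNoetherianRing _ _))
      refine (Set.finite_iUnion fun c => (this c).image (Sigma.mk c)).subset ?_
      rintro ⟨c, q⟩ ⟨-, hq⟩
      exact Set.mem_iUnion.mpr ⟨c, q, hq, rfl⟩
    obtain ⟨g', hg'⟩ := exists_forall_notMem_prime A (fun c => ρ c im) Q hQ (fun q hq => hq.1)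
      (fun q _ => by
        have hne : q.2.asIdeal.comap C ≠ ⊤ := Ideal.comap_ne_top _ q.2.2.ne_top
        obtain ⟨φ, hφ, -⟩ := exists_algHom_of_notMem (k := k) (q.2.asIdeal.comap C)
          (fun h => hne ((Ideal.eq_top_iff_one _).mpr h))
        obtain ⟨g, hg⟩ := hρ q.1 im φ
        exact ⟨g, fun h => hg (hφ h)⟩) (f im)
    refine ⟨Function.update g im g', fun c q hX hq => ?_⟩
    have hI : I c ≤ q.asIdeal := by
      refine Ideal.span_le.mpr ?_
      rintro _ ⟨i, hi, rfl⟩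
      have hne : i ≠ im := fun h => by simp [h, im] at hi
      have := hq i (Nat.lt_succ_of_lt hi)
      rwa [Function.update_of_ne hne] at this
    have him := hq im (Nat.lt_succ_self m)
    rw [Function.update_self] at him
    -- a component through `q` of a preceding solution set is strictly larger than `q`
    have key : ∀ J : Ideal (A c)[X], I c ≤ J → J ≤ q.asIdeal → (∀ p ∈ J.minimalPrimes,
        p ∈ (I c).minimalPrimes ∨ p ∈ (I c ⊔ (T c).map C).minimalPrimes) →
        ∃ p : PrimeSpectrum (A c)[X], J ≤ p.asIdeal ∧ p < q ∧ X ∉ p.asIdeal ∧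
          ∀ i : Fin n, i.1 < m → F c i ∈ p.asIdeal := by
      intro J hIJ hJ hmin
      obtain ⟨p, hp, hpq⟩ := Ideal.exists_minimalPrimes_le hJ
      have hXp : X ∉ p := fun h => hX (hpq h)
      refine ⟨⟨p, hp.1.1⟩, hp.1.2, lt_of_le_of_ne hpq ?_, hXp, fun i hi =>
        hp.1.2 (hIJ (Ideal.subset_span ⟨i, hi, rfl⟩))⟩
      rintro rfl
      exact hg' ⟨c, ⟨p, hp.1.1⟩⟩ ⟨hXp, hmin p hp⟩ him
    constructor
    · obtain ⟨p, -, hpq, hXp, hFp⟩ := key (I c) le_rfl hI fun p hp => Or.inl hp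
      calc Order.coheight q + (m + 1 : ℕ) = Order.coheight q + 1 + m := by push_cast; ring
        _ ≤ Order.coheight p + m := by gcongr; exact Order.coheight_add_one_le hpq
        _ ≤ _ := (hg c p hXp hFp).1
    · intro hTq
      obtain ⟨p, hTp, hpq, hXp, hFp⟩ := key (I c ⊔ (T c).map C) le_sup_left (sup_le hI hTq)
        fun p hp => Or.inr hp
      calc Order.coheight q + 1 + (m + 1 : ℕ) = Order.coheight q + 1 + 1 + m := by push_cast; ring
        _ ≤ Order.coheight p + 1 + m := by gcongr; exact Order.coheight_add_one_le hpq
        _ ≤ _ := (hg c p hXp hFp).2 (le_sup_right.trans hTp)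

/-- A system perturbed by a general multiple of a suitable second system has finitely many
solutions, none of them in a given nowhere dense closed set `T`. Off `X = 0`, the solutions of
`f + X g` on the product with a line form a curve, of which only finitely many points lie
over `T`; the exceptional `t` are zero and those for which `X = t` contains a component of the curve
or one of these points. -/
theorem exists_perturbation_finite (hdim : ∀ c, ringKrullDim (A c) ≤ n)
    (hρ : ∀ c i (φ : A c →ₐ[k] k), ∃ g, φ (ρ c i g) ≠ 0) (T : ∀ c, Ideal (A c))
    (hT : ∀ c, T c ≠ ⊥) (f : ∀ i, E i) :
    ∃ (g : ∀ i, E i) (B : Set k), B.Finite ∧ ∀ t ∉ B, ∀ c,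
      {φ : A c →ₐ[k] k | ∀ i, φ (ρ c i (f i + t • g i)) = 0}.Finite ∧
      ∀ φ : A c →ₐ[k] k, (∀ i, φ (ρ c i (f i + t • g i)) = 0) → ¬ T c ≤ RingHom.ker φ := by
  classical
  have _ : ∀ c, IsNoetherianRing (A c) := fun c => Algebra.FiniteType.isNoetherianRing k (A c)
  obtain ⟨g, hg⟩ := exists_perturbation_coheight A E ρ hdim hρ T hT f n le_rfl
  have hcancel : ∀ x : ℕ∞, ∀ y : ℕ, x + n ≤ n + y → x ≤ y := by
    intro x y h
    rw [add_comm] at h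
    exact (ENat.add_le_add_iff_left (ENat.natCast_ne_top n)).mp h
  let F : ∀ c, Fin n → (A c)[X] := fun c i => C (ρ c i (f i)) + X * C (ρ c i (g i))
  let I : ∀ c, Ideal (A c)[X] := fun c => Ideal.span (Set.range (F c))
  let P : ∀ c, Set (Ideal (A c)[X]) := fun c =>
    {q | X ∉ q ∧ q ∈ (I c).minimalPrimes ∪ (I c ⊔ (T c).map C).minimalPrimes}
  have hP : ∀ c, (P c).Finite := fun c =>
    ((Ideal.finite_minimalPrimes_of_isNoetherianRing _ _).union
      (Ideal.finite_minimalPrimes_of_isNoetherianRing _ _)).subset fun q hq => hq.2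
  have hPp : ∀ c, ∀ q ∈ P c, q.IsPrime := fun c q hq => hq.2.elim (fun h => h.1.1) (fun h => h.1.1)
  let B : Set k := {0} ∪ ⋃ c, ⋃ q ∈ P c, {t | X - C (algebraMap k (A c) t) ∈ q}
  have hB : B.Finite := by
    refine (Set.finite_singleton 0).union (Set.finite_iUnion fun c => (hP c).biUnion fun q hq => ?_)
    refine Set.Subsingleton.finite fun s hs t ht => ?_
    by_contra hst
    refine (hPp c q hq).ne_top (Ideal.eq_top_of_isUnit_mem _ (sub_mem hs ht) ?_)
    rw [sub_sub_sub_cancel_left, ← C_sub, ← map_sub]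
    exact ((sub_ne_zero.mpr (Ne.symm hst)).isUnit.map (algebraMap k (A c))).map C
  refine ⟨g, B, hB, fun t ht c => ?_⟩
  have ht0 : t ≠ 0 := fun h => ht (Or.inl h)
  have htq : ∀ q ∈ P c, X - C (algebraMap k (A c) t) ∉ q := fun q hq h =>
    ht (Or.inr (Set.mem_iUnion.mpr ⟨c, Set.mem_biUnion hq h⟩))
  -- the point `(φ, t)` of the product with the line
  let ev : (A c →ₐ[k] k) → ((A c)[X] →+* k) := fun φ =>
    φ.toRingHom.comp (Polynomial.evalRingHom (algebraMap k (A c) t))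
  have hev : ∀ φ p, ev φ p = φ (p.eval (algebraMap k (A c) t)) := fun φ p => rfl
  have hevX : ∀ φ, X ∉ RingHom.ker (ev φ) := fun φ h => ht0 (by
    simpa [RingHom.mem_ker, hev] using h)
  have hevt : ∀ φ, X - C (algebraMap k (A c) t) ∈ RingHom.ker (ev φ) := fun φ => by
    simp [RingHom.mem_ker, hev]
  have hevI : ∀ φ : A c →ₐ[k] k, (∀ i, φ (ρ c i (f i + t • g i)) = 0) →
      I c ≤ RingHom.ker (ev φ) := by
    intro φ hφ
    refine Ideal.span_le.mpr ?_
    rintro _ ⟨i, rfl⟩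
    have := hφ i
    rw [SetLike.mem_coe, RingHom.mem_ker, hev]
    simpa [F, mul_comm t] using this
  have hevp : ∀ φ, (RingHom.ker (ev φ)).IsPrime := fun φ => RingHom.ker_isPrime _
  constructor
  · have hinj : Set.InjOn (fun φ => RingHom.ker (ev φ))
        {φ : A c →ₐ[k] k | ∀ i, φ (ρ c i (f i + t • g i)) = 0} := by
      intro φ _ ψ _ h
      ext a
      have h1 : C (a - algebraMap k (A c) (φ a)) ∈ RingHom.ker (ev φ) := by
        simp [RingHom.mem_ker, hev]
      have h2 : C (a - algebraMap k (A c) (φ a)) ∈ RingHom.ker (ev ψ) := by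
        have h' : RingHom.ker (ev φ) = RingHom.ker (ev ψ) := h
        rwa [← h']
      rw [RingHom.mem_ker, hev, eval_C, map_sub, AlgHom.commutes] at h2
      exact (sub_eq_zero.mp h2).symm
    refine Set.Finite.of_finite_image (Set.Finite.subset ((hP c).biUnion fun q _ =>
      Ideal.finite_minimalPrimes_of_isNoetherianRing _
        (q ⊔ Ideal.span {X - C (algebraMap k (A c) t)})) ?_) hinj
    rintro _ ⟨φ, hφ, rfl⟩
    obtain ⟨q, hq, hqφ⟩ := Ideal.exists_minimalPrimes_le (hevI φ hφ)
    have hXq : X ∉ q := fun h => hevX φ (hqφ h)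
    have hqP : q ∈ P c := ⟨hXq, Or.inl hq⟩
    have hco := hcancel _ 1 ((hg c ⟨q, hq.1.1⟩ hXq fun i _ =>
      hq.1.2 (Ideal.subset_span ⟨i, rfl⟩)).1)
    -- with a prime strictly between `q` and the point `(φ, t)`, the curve would have dimension two
    refine Set.mem_biUnion hqP ⟨⟨hevp φ, sup_le hqφ ?_⟩, ?_⟩
    · rw [Ideal.span_le, Set.singleton_subset_iff]; exact hevt φ
    · rintro r ⟨hr, hqr⟩ hrφ
      by_contra hne
      have h1 : (⟨q, hq.1.1⟩ : PrimeSpectrum (A c)[X]) < ⟨r, hr⟩ :=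
        lt_of_le_of_ne (le_sup_left.trans hqr) fun h => htq q hqP (by
          have : q = r := congrArg PrimeSpectrum.asIdeal h
          rw [this]; exact hqr (le_sup_right (a := q) (Ideal.mem_span_singleton_self _)))
      have h2 : (⟨r, hr⟩ : PrimeSpectrum (A c)[X]) < ⟨_, hevp φ⟩ :=
        lt_of_le_not_ge hrφ hne
      have h3 := Order.coheight_add_one_le h1
      have h4 := Order.coheight_add_one_le h2
      have h5 : (1 : ℕ∞) + 1 ≤ 1 := by
        calc (1 : ℕ∞) + 1 ≤ _ + 1 + 1 := by gcongr; exact le_add_self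
          _ ≤ _ := (add_le_add_left h4 1).trans (h3.trans hco)
      exact absurd h5 (by decide)
  · intro φ hφ hTφ
    have hle : I c ⊔ (T c).map C ≤ RingHom.ker (ev φ) := by
      refine sup_le (hevI φ hφ) (Ideal.map_le_iff_le_comap.mpr fun a ha => ?_)
      simpa [RingHom.mem_ker, hev] using hTφ ha
    obtain ⟨q, hq, hqφ⟩ := Ideal.exists_minimalPrimes_le hle
    have hXq : X ∉ q := fun h => hevX φ (hqφ h)
    have hqP : q ∈ P c := ⟨hXq, Or.inr hq⟩
    have hco := hcancel _ 1 ((hg c ⟨q, hq.1.1⟩ hXq fun i _ =>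
      hq.1.2 (le_sup_left (a := I c) (Ideal.subset_span ⟨i, rfl⟩))).2 (le_sup_right.trans hq.1.2))
    have h1 : (⟨q, hq.1.1⟩ : PrimeSpectrum (A c)[X]) < ⟨_, hevp φ⟩ :=
      lt_of_le_of_ne hqφ fun h => htq q hqP (by
        have : q = _ := congrArg PrimeSpectrum.asIdeal h
        rw [this]; exact hevt φ)
    have h3 := Order.coheight_add_one_le h1
    have h5 : (1 : ℕ∞) + 1 ≤ 1 := by
      calc (1 : ℕ∞) + 1 ≤ _ + 1 + 1 := by gcongr; exact le_add_self
        _ ≤ _ := (add_le_add_left h3 1).trans hco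
    exact absurd h5 (by decide)
end

end

/-! ### Persistence of isolated solutions -/

section
open Polynomial TensorProduct


/-- A surjective ring homomorphism does not lower heights of preimages. -/
theorem height_le_height_comap_of_surjective {R S : Type*} [CommRing R] [CommRing S] (f : R →+* S)
    (hf : Function.Surjective f) (p : Ideal S) [p.IsPrime] :
    p.height ≤ (p.comap f).height := by
  have hmono : StrictMono (PrimeSpectrum.comap f) := by
    intro a b hab
    refine lt_of_le_of_ne (Ideal.comap_mono hab.le) fun h => hab.ne ?_
    exact PrimeSpectrum.comap_injective_of_surjective f hf h
  have := Order.height_le_height_apply_of_strictMono _ hmono ⟨p, ‹_›⟩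
  rwa [← PrimeSpectrum.height_eq_orderHeight, ← PrimeSpectrum.height_eq_orderHeight] at this

/-- The local dimension of a product of varieties is at least the sum of the local dimensions. -/
theorem height_add_height_le_height_ker_lift {k A B : Type u} [Field k] [CommRing A] [CommRing B]
    [Algebra k A] [Algebra k B] [Algebra.FiniteType k A] [Algebra.FiniteType k B]
    (φ : A →ₐ[k] k) (ψ : B →ₐ[k] k) :
    (RingHom.ker φ).height + (RingHom.ker ψ).height ≤
      (RingHom.ker (Algebra.TensorProduct.lift φ ψ fun _ _ => .all _ _ :
        A ⊗[k] B →ₐ[k] k)).height := by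
  have _ : Algebra.FiniteType k (A ⊗[k] B) := Algebra.FiniteType.trans (S := A) ‹_› inferInstance
  have _ : IsNoetherianRing A := Algebra.FiniteType.isNoetherianRing k A
  have _ : IsNoetherianRing (A ⊗[k] B) := Algebra.FiniteType.isNoetherianRing k _
  let Φ : A ⊗[k] B →ₐ[k] k := Algebra.TensorProduct.lift φ ψ fun _ _ => .all _ _
  have hp : (RingHom.ker φ).IsPrime := RingHom.ker_isPrime _
  have hq : (RingHom.ker ψ).IsPrime := RingHom.ker_isPrime _
  have hP : (RingHom.ker Φ).IsPrime := RingHom.ker_isPrime _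
  have hover : (RingHom.ker Φ).LiesOver (RingHom.ker φ) := ⟨by
    ext a
    simp [RingHom.mem_ker, Φ, Ideal.mem_comap]⟩
  rw [Ideal.height_eq_height_add_of_liesOver_of_hasGoingDown (RingHom.ker φ) (RingHom.ker Φ)]
  gcongr
  -- the fibre over the point `φ` is `B`
  let I := (RingHom.ker φ).map (algebraMap A (A ⊗[k] B))
  let π₀ : A ⊗[k] B →ₐ[k] B :=
    Algebra.TensorProduct.lift ((Algebra.ofId k B).comp φ) (AlgHom.id k B) fun _ _ => .all _ _
  have hI : ∀ x ∈ I, π₀ x = 0 := by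
    have : I ≤ RingHom.ker π₀ := by
      refine Ideal.map_le_iff_le_comap.mpr fun a ha => ?_
      have ha' : φ a = 0 := ha
      simp [π₀, RingHom.mem_ker, Ideal.mem_comap, ha']
    exact fun x hx => this hx
  let π : (A ⊗[k] B) ⧸ I →+* B := Ideal.Quotient.lift I π₀.toRingHom hI
  have hπ : Function.Surjective π := fun b => ⟨Ideal.Quotient.mk I (1 ⊗ₜ b), by simp [π, π₀]⟩
  have hcomp : ∀ x, ψ (π₀ x) = Φ x := by
    intro x
    have : ψ.comp π₀ = Φ := by
      ext x <;> simp [π₀, Φ, Algebra.ofId_apply]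
    exact DFunLike.congr_fun this x
  have hle := height_le_height_comap_of_surjective π hπ (RingHom.ker ψ)
  refine hle.trans (Ideal.height_mono ?_)
  intro x hx
  obtain ⟨x, rfl⟩ := Ideal.Quotient.mk_surjective x
  refine Ideal.mem_map_of_mem _ ?_
  have hx' : ψ (π₀ x) = 0 := hx
  rwa [hcomp] at hx'

/-- The product `B` of `K` affine varieties, with the point given by a point of each factor: if the
factors have local dimension at least `n`, the product has local dimension at least `K n`. -/
theorem exists_product {k : Type u} [Field k] (K n : ℕ) (A : Fin K → Type u)
    [∀ j, CommRing (A j)] [∀ j, Algebra k (A j)] [∀ j, Algebra.FiniteType k (A j)]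
    (φ : ∀ j, A j →ₐ[k] k) (hφ : ∀ j, n ≤ (RingHom.ker (φ j)).height) :
    ∃ (B : Type u) (_ : CommRing B) (_ : Algebra k B) (_ : Algebra.FiniteType k B)
      (ι : ∀ j, A j →ₐ[k] B) (Φ : B →ₐ[k] k), (∀ j, Φ.comp (ι j) = φ j) ∧
      (⨆ j, (ι j).range = ⊤) ∧ (K * n : ℕ) ≤ (RingHom.ker Φ).height := by
  induction K with
  | zero =>
    refine ⟨k, inferInstance, inferInstance, inferInstance, fun j => j.elim0, AlgHom.id k k,
      fun j => j.elim0, ?_, by simp⟩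
    exact Subsingleton.elim _ _
  | succ K ih =>
    obtain ⟨B, _, _, _, ι, Φ, hΦ, htop, hht⟩ := ih (fun j => A j.succ) (fun j => φ j.succ)
      fun j => hφ j.succ
    have _ : Algebra.FiniteType k (A 0 ⊗[k] B) :=
      Algebra.FiniteType.trans (S := A 0) inferInstance inferInstance
    let ι' : ∀ j, A j →ₐ[k] A 0 ⊗[k] B := Fin.cases
      (Algebra.TensorProduct.includeLeft)
      (fun j => (Algebra.TensorProduct.includeRight).comp (ι j))
    refine ⟨A 0 ⊗[k] B, inferInstance, inferInstance, inferInstance, ι',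
      Algebra.TensorProduct.lift (φ 0) Φ fun _ _ => .all _ _, ?_, ?_, ?_⟩
    · intro j
      refine Fin.cases ?_ (fun j => ?_) j
      · ext x; simp [ι']
      · ext x
        rw [← hΦ j]; simp [ι']
    · rw [eq_top_iff]
      have h0 : (Algebra.TensorProduct.includeLeft : A 0 →ₐ[k] A 0 ⊗[k] B).range ≤
          ⨆ j, (ι' j).range := le_iSup (fun j => (ι' j).range) 0
      have h1 : (Algebra.TensorProduct.includeRight : B →ₐ[k] A 0 ⊗[k] B).range ≤
          ⨆ j, (ι' j).range := by
        rw [← Algebra.map_top, ← htop, Subalgebra.map_le]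
        refine iSup_le fun j => ?_
        rintro _ ⟨x, rfl⟩
        exact le_iSup (fun j => (ι' j).range) j.succ ⟨x, rfl⟩
      rintro x -
      induction x with
      | zero => exact zero_mem _
      | add x y hx hy => exact add_mem hx hy
      | tmul a b =>
        have : a ⊗ₜ[k] b = (a ⊗ₜ 1) * (1 ⊗ₜ b) := by simp
        rw [this]
        exact mul_mem (h0 ⟨a, rfl⟩) (h1 ⟨b, rfl⟩)
    · refine le_trans ?_ (height_add_height_le_height_ker_lift (φ 0) Φ)
      calc (((K + 1) * n : ℕ) : ℕ∞) = n + (K * n : ℕ) := by push_cast; ring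
        _ ≤ _ := add_le_add (hφ 0) hht

/-- Isolated solutions `φ j` of a system `f` persist under a perturbation: for some `t` outside a
given finite set, the system `f + t g` has solutions `ψ j` on the same charts, and these are still
separated by those functions `a j l` on products of two charts that separate the `φ j`. -/
theorem exists_solutions_of_perturbation {k : Type u} [Field k] [IsAlgClosed k] {K n : ℕ}
    (A : Fin K → Type u) [∀ j, CommRing (A j)] [∀ j, Algebra k (A j)]
    [∀ j, Algebra.FiniteType k (A j)] (E : Fin n → Type*) [∀ i, AddCommGroup (E i)]
    [∀ i, Module k (E i)] (ρ : ∀ j i, E i →ₗ[k] A j) (φ : ∀ j, A j →ₐ[k] k)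
    (hφ : ∀ j, n ≤ (RingHom.ker (φ j)).height) (f g : ∀ i, E i)
    (hf : ∀ j, RingHom.ker (φ j) ∈ (Ideal.span (Set.range fun i => ρ j i (f i))).minimalPrimes)
    (a : ∀ j l, A j ⊗[k] A l)
    (ha : ∀ j l, j ≠ l → Algebra.TensorProduct.lift (φ j) (φ l) (fun _ _ => .all _ _) (a j l) ≠ 0)
    (B : Set k) (hB : B.Finite) :
    ∃ t ∉ B, ∃ ψ : ∀ j, A j →ₐ[k] k, (∀ j i, ψ j (ρ j i (f i + t • g i)) = 0) ∧
      ∀ j l, j ≠ l → Algebra.TensorProduct.lift (ψ j) (ψ l) (fun _ _ => .all _ _) (a j l) ≠ 0 := by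
  classical
  obtain ⟨R, _, _, _, ι, Φ, hΦ, htop, hht⟩ := exists_product K n A φ hφ
  have _ : IsNoetherianRing R := Algebra.FiniteType.isNoetherianRing k R
  -- the system on the product with a line
  let F : Fin K × Fin n → R[X] := fun s =>
    C (ι s.1 (ρ s.1 s.2 (f s.2))) + X * C (ι s.1 (ρ s.1 s.2 (g s.2)))
  let Ψ : R[X] →ₐ[k] k := Φ.comp ((Polynomial.aeval (0 : R)).restrictScalars k)
  have hΨ : ∀ p, Ψ p = Φ (p.eval 0) := fun p => by simp [Ψ]
  have hker : (RingHom.ker Φ).IsMaximal :=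
    RingHom.ker_isMaximal_of_surjective Φ fun c => ⟨algebraMap k R c, Φ.commutes c⟩
  have hMmax : (RingHom.ker Ψ).IsMaximal :=
    RingHom.ker_isMaximal_of_surjective Ψ fun c => ⟨algebraMap k _ c, Ψ.commutes c⟩
  have hover : (RingHom.ker Ψ).LiesOver (RingHom.ker Φ) := ⟨by
    ext x
    rw [Ideal.mem_comap, RingHom.mem_ker, RingHom.mem_ker, hΨ, Polynomial.algebraMap_apply]
    simp⟩
  have hMht : ((K * n : ℕ) : ℕ∞) + 1 ≤ (RingHom.ker Ψ).height := by
    rw [Polynomial.height_eq_height_add_one (RingHom.ker Φ) (RingHom.ker Ψ)]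
    gcongr
  have hΦι : ∀ j x, Φ (ι j x) = φ j x := fun j x => DFunLike.congr_fun (hΦ j) x
  have hφf : ∀ j i, φ j (ρ j i (f i)) = 0 := fun j i =>
    (hf j).1.2 (Ideal.subset_span ⟨i, rfl⟩)
  have hFM : ∀ s, F s ∈ RingHom.ker Ψ := by
    intro s
    rw [RingHom.mem_ker, hΨ]
    simp [F, hΦι, hφf]
  -- by Krull's height theorem the solution is not isolated on the product with the line
  obtain ⟨p, hp, hFp, hpM, hXp⟩ : ∃ p : Ideal R[X], p.IsPrime ∧ (∀ s, F s ∈ p) ∧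
      p ≤ RingHom.ker Ψ ∧ X ∉ p := by
    by_contra! hcon
    have hmin : RingHom.ker Ψ ∈ (Ideal.span (Set.range F)).minimalPrimes := by
      refine ⟨⟨hMmax.isPrime, Ideal.span_le.mpr ?_⟩, ?_⟩
      · rintro _ ⟨s, rfl⟩; exact hFM s
      · rintro p ⟨hp, hFp⟩ hpM
        have hFp' : ∀ s, F s ∈ p := fun s => hFp (Ideal.subset_span ⟨s, rfl⟩)
        have hX : X ∈ p := hcon p hp hFp' hpM
        -- `p` contains the maximal ideals of the factors
        have hj : ∀ j x, C (ι j (x - algebraMap k _ (φ j x))) ∈ p := by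
          intro j x
          let q : Ideal (A j) := p.comap (C.comp (ι j).toRingHom)
          have hq : q.IsPrime := Ideal.comap_isPrime _ _
          have hqf : Ideal.span (Set.range fun i => ρ j i (f i)) ≤ q := by
            refine Ideal.span_le.mpr ?_
            rintro _ ⟨i, rfl⟩
            have := p.sub_mem (hFp' (j, i)) (p.mul_mem_right (C (ι j (ρ j i (g i)))) hX)
            simpa [F, q] using this
          have hqφ : q ≤ RingHom.ker (φ j) := by
            intro x hx
            have h1 := hpM hx
            rw [RingHom.mem_ker, hΨ] at h1
            simpa [hΦι] using h1
          refine (hf j).2 ⟨hq, hqf⟩ hqφ ?_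
          simp [RingHom.mem_ker]
        have hconst : ∀ r : R, C (r - algebraMap k R (Φ r)) ∈ p := by
          let W : Subalgebra k R :=
            { carrier := {r | C (r - algebraMap k R (Φ r)) ∈ p}
              mul_mem' := fun {r s} hr hs => by
                have : C (r * s - algebraMap k R (Φ (r * s))) =
                    C (r - algebraMap k R (Φ r)) * C s +
                      C (algebraMap k R (Φ r)) * C (s - algebraMap k R (Φ s)) := by
                  simp only [map_mul, map_sub]; ring
                change C (r * s - algebraMap k R (Φ (r * s))) ∈ p
                rw [this]
                exact p.add_mem (p.mul_mem_right _ hr) (p.mul_mem_left _ hs)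
              add_mem' := fun {r s} hr hs => by
                have : C (r + s - algebraMap k R (Φ (r + s))) =
                    C (r - algebraMap k R (Φ r)) + C (s - algebraMap k R (Φ s)) := by
                  simp only [map_add, map_sub]; ring
                change C (r + s - algebraMap k R (Φ (r + s))) ∈ p
                rw [this]
                exact p.add_mem hr hs
              algebraMap_mem' := fun c => by simp }
          have hW : (⊤ : Subalgebra k R) ≤ W := by
            rw [← htop]
            refine iSup_le fun j => ?_
            rintro _ ⟨x, rfl⟩
            have := hj j x
            rw [map_sub, AlgHom.commutes] at this
            change C (ι j x - algebraMap k R (Φ (ι j x))) ∈ p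
            rwa [hΦι]
          exact fun r => hW (Algebra.mem_top : r ∈ ⊤)
        intro P hP
        rw [RingHom.mem_ker, hΨ] at hP
        have h1 := hconst (P.eval 0)
        rw [hP, map_zero, sub_zero] at h1
        have h2 : P = C (P.eval 0) + X * P.divX := by
          rw [← Polynomial.coeff_zero_eq_eval_zero, add_comm]
          exact (Polynomial.X_mul_divX_add P).symm
        rw [h2]
        exact p.add_mem h1 (p.mul_mem_right _ hX)
    have h1 := Ideal.height_le_card_of_mem_minimalPrimes_span (Set.finite_range F) hmin
    have h2 : (Set.range F).ncard ≤ K * n := by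
      rw [← Set.image_univ]
      refine (Set.ncard_image_le Set.finite_univ).trans ?_
      simp
    have h3 := hMht.trans h1
    have h4 : K * n + 1 ≤ (Set.range F).ncard := by exact_mod_cast h3
    omega
  -- the conditions to be met by the new solution
  let sep : Fin K × Fin K → R[X] := fun s => if s.1 = s.2 then 1 else
    C (Algebra.TensorProduct.lift (ι s.1) (ι s.2) (fun _ _ => .all _ _) (a s.1 s.2))
  have hlift : ∀ (χ : R →ₐ[k] k) j l, χ (Algebra.TensorProduct.lift (ι j) (ι l)
      (fun _ _ => .all _ _) (a j l)) = Algebra.TensorProduct.lift (χ.comp (ι j)) (χ.comp (ι l))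
      (fun _ _ => .all _ _) (a j l) := by
    intro χ j l
    have : χ.comp (Algebra.TensorProduct.lift (ι j) (ι l) (fun _ _ => .all _ _)) =
        Algebra.TensorProduct.lift (χ.comp (ι j)) (χ.comp (ι l)) (fun _ _ => .all _ _) := by
      ext x <;> simp
    exact DFunLike.congr_fun this (a j l)
  let δ : R[X] := X * ((∏ s, sep s) * ∏ t ∈ hB.toFinset \ {0}, (X - C (algebraMap k R t)))
  have hδ : δ ∉ p := by
    refine hp.mul_notMem hXp (hp.mul_notMem ?_ ?_)
    · intro h
      obtain ⟨s, -, h⟩ := hp.prod_mem_iff.mp h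
      by_cases hs : s.1 = s.2
      · simp only [sep, if_pos hs] at h
        exact hp.ne_top ((Ideal.eq_top_iff_one _).mpr h)
      · simp only [sep, if_neg hs] at h
        have h1 := hpM h
        rw [RingHom.mem_ker, hΨ, eval_C, hlift, hΦ, hΦ] at h1
        exact ha _ _ hs h1
    · intro h
      obtain ⟨t, ht, h⟩ := hp.prod_mem_iff.mp h
      have h1 := hpM h
      rw [RingHom.mem_ker, hΨ] at h1
      simp at h1
      simp [h1] at ht
  obtain ⟨Θ, hpΘ, hδΘ⟩ := exists_algHom_of_notMem (k := k) p hδ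
  have hX0 : Θ X ≠ 0 := fun h => hδΘ (by simp [δ, h])
  let χ : R →ₐ[k] k := Θ.comp (Polynomial.CAlgHom)
  have hχ : ∀ r, χ r = Θ (C r) := fun r => rfl
  refine ⟨Θ X, fun hmem => hδΘ ?_, fun j => χ.comp (ι j), fun j i => ?_, fun j l hjl h => hδΘ ?_⟩
  · have : Θ (X - C (algebraMap k R (Θ X))) = 0 := by
      rw [map_sub, ← hχ, AlgHom.commutes]; simp
    have h0 : ∏ t ∈ hB.toFinset \ {0}, Θ (X - C (algebraMap k R t)) = 0 :=
      Finset.prod_eq_zero (i := Θ X) (by simp [hmem, hX0]) this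
    simp only [δ, map_mul]
    rw [map_prod Θ _ (hB.toFinset \ {0}), h0, mul_zero, mul_zero]
  · have h1 : Θ (F (j, i)) = 0 := hpΘ (hFp (j, i))
    simp only [F, map_add, map_mul] at h1
    rw [map_add, map_smul, map_add, map_smul, smul_eq_mul]
    exact h1
  · have : Θ (sep (j, l)) = 0 := by
      simp only [sep, if_neg hjl]
      rw [← hχ, hlift]
      exact h
    have h0 : ∏ s, Θ (sep s) = 0 := Finset.prod_eq_zero (Finset.mem_univ (j, l)) this
    simp only [δ, map_mul]
    rw [map_prod Θ sep, h0, zero_mul, mul_zero]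

end

/-! ### Systems of equations on a smooth variety -/

section
open TensorProduct

/-- The algebraic content of a system of `n` equations on a smooth `n`-dimensional variety `U`
over `k`, the `i`-th equation being taken from the linear system `E i`: finitely many affine charts
`A c` covering `U`, the maps `ρ c i` restricting the linear systems to the charts, and the
inclusion `pt c` of the `k`-points of the chart into the set `P` of points of `U`. -/
structure SystemAtlas (k : Type u) [Field k] (P : Type*) {n : ℕ} (E : Fin n → Type*)
    [∀ i, AddCommGroup (E i)] [∀ i, Module k (E i)] where
  /-- the index set of the charts -/
  κ : Type
  finite : Finite κ
  /-- the coordinate rings of the charts -/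
  A : κ → Type u
  commRing : ∀ c, CommRing (A c)
  isDomain : ∀ c, IsDomain (A c)
  algebra : ∀ c, Algebra k (A c)
  finiteType : ∀ c, Algebra.FiniteType k (A c)
  dim_le : ∀ c, ringKrullDim (A c) ≤ n
  le_height : ∀ c (φ : A c →ₐ[k] k), n ≤ (RingHom.ker φ).height
  /-- the restriction of the linear systems to the charts -/
  ρ : ∀ c i, E i →ₗ[k] A c
  exists_ne_zero : ∀ c i (φ : A c →ₐ[k] k), ∃ g, φ (ρ c i g) ≠ 0
  /-- the point given by a homomorphism to `k` -/
  pt : ∀ c, (A c →ₐ[k] k) → P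
  pt_injective : ∀ c, Function.Injective (pt c)
  /-- distinct points are separated by an equation of the diagonal -/
  exists_separator : ∀ c d (φ : A c →ₐ[k] k) (ψ : A d →ₐ[k] k), pt c φ ≠ pt d ψ →
    ∃ a : A c ⊗[k] A d, Algebra.TensorProduct.lift φ ψ (fun _ _ => .all _ _) a ≠ 0 ∧
      ∀ (φ' : A c →ₐ[k] k) (ψ' : A d →ₐ[k] k),
        Algebra.TensorProduct.lift φ' ψ' (fun _ _ => .all _ _) a ≠ 0 → pt c φ' ≠ pt d ψ'

namespace SystemAtlas

attribute [instance] finite commRing isDomain algebra finiteType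

variable {k : Type u} [Field k] [IsAlgClosed k] {P : Type*} {n : ℕ} {E : Fin n → Type*}
  [∀ i, AddCommGroup (E i)] [∀ i, Module k (E i)] (𝒜 : SystemAtlas k P E)

/-- The solutions of the system `f` outside the closed set given by the ideals `J`. -/
def solutionsOff (J : ∀ c, Ideal (𝒜.A c)) (f : ∀ i, E i) : Set P :=
  {x | ∃ (c : 𝒜.κ) (φ : 𝒜.A c →ₐ[k] k), 𝒜.pt c φ = x ∧ (∀ i, φ (𝒜.ρ c i (f i)) = 0) ∧
    ¬ J c ≤ RingHom.ker φ}

omit [IsAlgClosed k] in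
theorem not_top_le_ker (c : 𝒜.κ) (φ : 𝒜.A c →ₐ[k] k) : ¬ (⊤ : Ideal (𝒜.A c)) ≤ RingHom.ker φ :=
  fun h => (RingHom.ker_isPrime φ).ne_top (top_le_iff.mp h)

theorem exists_bound [∀ i, FiniteDimensional k (E i)] :
    ∃ N : ℕ, ∀ f : ∀ i, E i, (𝒜.solutionsOff (fun _ => ⊤) f).Finite →
      (𝒜.solutionsOff (fun _ => ⊤) f).ncard ≤ N := by
  classical
  choose N hN using fun c => exists_bound_of_finite_solutions E (𝒜.ρ c)
  have _ := Fintype.ofFinite 𝒜.κ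
  refine ⟨∑ c, N c, fun f hf => ?_⟩
  let s : 𝒜.κ → Set P := fun c =>
    𝒜.pt c '' {φ : 𝒜.A c →ₐ[k] k | ∀ i, φ (𝒜.ρ c i (f i)) = 0}
  have hs : 𝒜.solutionsOff (fun _ => ⊤) f = ⋃ c, s c := by
    ext x
    simp only [solutionsOff, Set.mem_ofPred_eq, not_top_le_ker, not_false_eq_true, and_true,
      Set.mem_iUnion, s, Set.mem_image]
    exact exists_congr fun c => exists_congr fun φ => and_comm
  rw [hs] at hf ⊢
  have hfin : ∀ c, {φ : 𝒜.A c →ₐ[k] k | ∀ i, φ (𝒜.ρ c i (f i)) = 0}.Finite := fun c =>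
    (Set.finite_image_iff (𝒜.pt_injective c).injOn).mp (hf.subset (Set.subset_iUnion s c))
  calc (⋃ c, s c).ncard ≤ ∑ c, (s c).ncard := Set.ncard_iUnion_le_of_fintype s
    _ ≤ ∑ c, N c := Finset.sum_le_sum fun c _ =>
      (Set.ncard_image_le (hfin c)).trans (hN c f (hfin c))

/-- A system with finitely many solutions off the closed set `J` can be perturbed to a system with
at least as many solutions, all of them off the nowhere dense closed set `T`. -/
theorem exists_perturbation (J T : ∀ c, Ideal (𝒜.A c)) (hT : ∀ c, T c ≠ ⊥) (f : ∀ i, E i)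
    (hf : (𝒜.solutionsOff J f).Finite) :
    ∃ f' : ∀ i, E i, (𝒜.solutionsOff (fun _ => ⊤) f').Finite ∧
      𝒜.solutionsOff (fun _ => ⊤) f' = 𝒜.solutionsOff T f' ∧
      (𝒜.solutionsOff J f).ncard ≤ (𝒜.solutionsOff (fun _ => ⊤) f').ncard := by
  classical
  have _ := Fintype.ofFinite 𝒜.κ
  obtain ⟨g, B, hB, hg⟩ := exists_perturbation_finite 𝒜.A E 𝒜.ρ 𝒜.dim_le 𝒜.exists_ne_zero T hT f
  -- an enumeration of the given solutions
  have _ : Finite (𝒜.solutionsOff J f) := hf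
  let e := Finite.equivFin (𝒜.solutionsOff J f)
  choose c φ hpt hφ hφJ using fun j => (e.symm j).2
  -- a component of the solution set through a given solution has no other points off `J`
  have hmin : ∀ j, RingHom.ker (φ j) ∈
      (Ideal.span (Set.range fun i => 𝒜.ρ (c j) i (f i))).minimalPrimes := by
    intro j
    refine ⟨⟨RingHom.ker_isPrime _, Ideal.span_le.mpr ?_⟩, ?_⟩
    · rintro _ ⟨i, rfl⟩
      exact hφ j i
    · rintro q ⟨hq, hfq⟩ hqφ
      obtain ⟨φ', hφ'⟩ := exists_ker_eq_of_finite q (J (c j)) (fun h => hφJ j (h.trans hqφ)) <| by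
        refine Set.Finite.of_finite_image (f := 𝒜.pt (c j)) (hf.subset ?_)
          (𝒜.pt_injective _).injOn
        rintro _ ⟨χ, ⟨hqχ, hχ⟩, rfl⟩
        exact ⟨c j, χ, rfl, fun i => hqχ (hfq (Ideal.subset_span ⟨i, rfl⟩)), hχ⟩
      have hmax : (RingHom.ker φ').IsMaximal :=
        RingHom.ker_isMaximal_of_surjective φ' fun x => ⟨algebraMap k _ x, φ'.commutes x⟩
      rw [hφ'] at hmax
      exact (hmax.eq_of_le (RingHom.ker_isPrime (φ j)).ne_top hqφ).ge
  have hsep : ∀ j l, ∃ a : 𝒜.A (c j) ⊗[k] 𝒜.A (c l), j ≠ l →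
      Algebra.TensorProduct.lift (φ j) (φ l) (fun _ _ => .all _ _) a ≠ 0 ∧
      ∀ (φ' : 𝒜.A (c j) →ₐ[k] k) (ψ' : 𝒜.A (c l) →ₐ[k] k),
        Algebra.TensorProduct.lift φ' ψ' (fun _ _ => .all _ _) a ≠ 0 →
          𝒜.pt (c j) φ' ≠ 𝒜.pt (c l) ψ' := by
    intro j l
    by_cases h : j = l
    · exact ⟨0, fun h' => absurd h h'⟩
    · obtain ⟨a, ha⟩ := 𝒜.exists_separator (c j) (c l) (φ j) (φ l) fun h' => h <| by
        rw [hpt, hpt] at h'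
        exact e.symm.injective (Subtype.ext h')
      exact ⟨a, fun _ => ha⟩
  choose a ha using hsep
  obtain ⟨t, htB, ψ, hψ, hψa⟩ := exists_solutions_of_perturbation (fun j => 𝒜.A (c j)) E
    (fun j => 𝒜.ρ (c j)) φ (fun j => 𝒜.le_height _ _) f g hmin a (fun j l h => (ha j l h).1) B hB
  refine ⟨fun i => f i + t • g i, ?_⟩
  have hfin : (𝒜.solutionsOff (fun _ => ⊤) fun i => f i + t • g i).Finite := by
    refine (Set.finite_iUnion fun c => ((hg t htB c).1.image (𝒜.pt c))).subset ?_
    rintro x ⟨d, χ, rfl, hχ, -⟩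
    exact Set.mem_iUnion.mpr ⟨d, χ, hχ, rfl⟩
  refine ⟨hfin, ?_, ?_⟩
  · ext x
    constructor
    · rintro ⟨d, χ, rfl, hχ, -⟩
      exact ⟨d, χ, rfl, hχ, (hg t htB d).2 χ hχ⟩
    · rintro ⟨d, χ, rfl, hχ, -⟩
      exact ⟨d, χ, rfl, hχ, 𝒜.not_top_le_ker _ _⟩
  · have hinj : Function.Injective fun j => 𝒜.pt (c j) (ψ j) := by
      intro j l h
      by_contra hjl
      exact (ha j l hjl).2 _ _ (hψa j l hjl) h
    calc (𝒜.solutionsOff J f).ncard = (Set.range fun j => 𝒜.pt (c j) (ψ j)).ncard := by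
          rw [← Set.image_univ, Set.ncard_image_of_injective _ hinj, Set.ncard_univ, Nat.card_fin]
          rfl
      _ ≤ _ := by
          refine Set.ncard_le_ncard ?_ hfin
          rintro _ ⟨j, rfl⟩
          exact ⟨c j, ψ j, rfl, hψ j, 𝒜.not_top_le_ker _ _⟩

end SystemAtlas

end

/-! ### Coordinate rings and local rings of a complex variety -/

namespace ComplexVariety

instance isLocallyNoetherian (X : ComplexVariety) : IsLocallyNoetherian X.scheme :=
  LocallyOfFiniteType.isLocallyNoetherian X.str

instance compactSpace (X : ComplexVariety) : CompactSpace X.scheme :=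
  (quasiCompact_iff_compactSpace (f := X.str)).mp X.quasiCompact

instance jacobsonSpace (X : ComplexVariety) : JacobsonSpace X.scheme :=
  LocallyOfFiniteType.jacobsonSpace X.str

variable {X : ComplexVariety}

/-- The inclusion of the constants makes the regular functions on an open set a `ℂ`-algebra. -/
noncomputable instance algebraSection (U : X.scheme.Opens) : Algebra ℂ Γ(X.scheme, U) :=
  ((Scheme.ΓSpecIso (CommRingCat.of ℂ)).inv ≫ X.str.appLE ⊤ U le_top).hom.toAlgebra

theorem germ_algebraMap (U : X.scheme.Opens) (x : X.scheme) (hx : x ∈ U) (c : ℂ) :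
    X.scheme.presheaf.germ U x hx (algebraMap ℂ Γ(X.scheme, U) c) =
      algebraMap ℂ (X.scheme.presheaf.stalk x) c := by
  have : (Scheme.ΓSpecIso (CommRingCat.of ℂ)).inv ≫ X.str.appLE ⊤ U le_top ≫
      X.scheme.presheaf.germ U x hx = (Scheme.ΓSpecIso (CommRingCat.of ℂ)).inv ≫ X.str.appTop ≫
      X.scheme.presheaf.germ ⊤ x trivial := by
    have h : X.str.appLE ⊤ U le_top =
        X.str.appTop ≫ X.scheme.presheaf.map (homOfLE le_top).op := rfl
    rw [h, Category.assoc, TopCat.Presheaf.germ_res]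
  exact congr($(this) c)

/-- The germ at a point, as a homomorphism of `ℂ`-algebras. -/
noncomputable def germAlgHom (U : X.scheme.Opens) (x : X.scheme) (hx : x ∈ U) :
    Γ(X.scheme, U) →ₐ[ℂ] X.scheme.presheaf.stalk x :=
  { (X.scheme.presheaf.germ U x hx).hom with commutes' := germ_algebraMap U x hx }

theorem finiteType_section {U : X.scheme.Opens} (hU : IsAffineOpen U) :
    Algebra.FiniteType ℂ Γ(X.scheme, U) := by
  have h := LocallyOfFiniteType.finiteType_appLE X.str (isAffineOpen_top _) hU le_top
  have h2 : ((Scheme.ΓSpecIso (CommRingCat.of ℂ)).inv).hom.FiniteType :=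
    RingHom.FiniteType.of_surjective _
      (ConcreteCategory.bijective_of_isIso (Scheme.ΓSpecIso (CommRingCat.of ℂ)).inv).2
  exact h.comp h2

/-- The local rings of `X` at smooth points are normal domains. -/
theorem isDomain_and_isIntegrallyClosed_stalk {x : X.scheme} (hx : x ∈ X.str.smoothLocus) :
    IsDomain (X.scheme.presheaf.stalk x) ∧ IsIntegrallyClosed (X.scheme.presheaf.stalk x) := by
  obtain ⟨_, ⟨V, hV, rfl⟩, hxV, -⟩ :=
    X.scheme.isBasis_affineOpens.exists_subset_of_mem_open (Set.mem_univ x) isOpen_univ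
  have hfp := X.str.finitePresentation_appLE (isAffineOpen_top _) hV le_top
  -- the base ring of the smooth algebra is `Γ(Spec ℂ, ⊤)`, which is a field
  let R := Γ(Spec (CommRingCat.of ℂ), ⊤)
  let e : R ≃+* ℂ := (Scheme.ΓSpecIso (CommRingCat.of ℂ)).commRingCatIsoToRingEquiv
  let _ : Field R := (e.isField (Field.toIsField ℂ)).toField
  algebraize [(X.str.appLE ⊤ V le_top).hom]
  have hs := (formallySmooth_stalkMap_iff (f := X.str) ⊤ (isAffineOpen_top _) V hV le_top hxV).mp hx
  have : Algebra.IsSmoothAt R (hV.primeIdealOf ⟨x, hxV⟩).asIdeal := hs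
  obtain ⟨h1, h2⟩ := isDomain_and_isIntegrallyClosed_of_isSmoothAt (R := R) (A := Γ(X.scheme, V))
    (hV.primeIdealOf ⟨x, hxV⟩).asIdeal
  let _ := X.scheme.presheaf.algebra_section_stalk ⟨x, hxV⟩
  have _ := hV.isLocalization_stalk ⟨x, hxV⟩
  let e' := IsLocalization.algEquiv (hV.primeIdealOf ⟨x, hxV⟩).asIdeal.primeCompl
    (Localization.AtPrime (hV.primeIdealOf ⟨x, hxV⟩).asIdeal) (X.scheme.presheaf.stalk x)
  exact ⟨e'.symm.injective.isDomain e'.symm.toRingHom,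
    IsIntegrallyClosed.of_equiv e'.toRingEquiv⟩

/-- A point with an integral local ring has arbitrarily small affine neighbourhoods with an
integral coordinate ring. -/
theorem exists_isAffineOpen_isDomain (x : X.scheme) [IsDomain (X.scheme.presheaf.stalk x)]
    (W : X.scheme.Opens) (hW : x ∈ W) :
    ∃ V : X.scheme.Opens, x ∈ V ∧ IsAffineOpen V ∧ V ≤ W ∧ IsDomain Γ(X.scheme, V) := by
  obtain ⟨V, hxV, hV, hVW, hinj⟩ := X.scheme.exists_le_and_germ_injective x W hW
  exact ⟨V, hxV, hV, hVW, hinj.isDomain (X.scheme.presheaf.germ V x hxV).hom⟩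

end ComplexVariety

/-! ### Charts -/

namespace ComplexVariety

variable {X : ComplexVariety}

section Affine

variable {U : X.scheme.Opens} (hU : IsAffineOpen U) {x : X.scheme} (hx : x ∈ U)

include hU in
theorem isUnit_germ_iff (b : Γ(X.scheme, U)) :
    IsUnit (X.scheme.presheaf.germ U x hx b) ↔ b ∉ (hU.primeIdealOf ⟨x, hx⟩).asIdeal := by
  let _ := X.scheme.presheaf.algebra_section_stalk ⟨x, hx⟩
  have _ := hU.isLocalization_stalk ⟨x, hx⟩
  exact IsLocalization.AtPrime.isUnit_to_map_iff (X.scheme.presheaf.stalk x)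
    (hU.primeIdealOf ⟨x, hx⟩).asIdeal b

theorem germ_mem_maximalIdeal_iff (b : Γ(X.scheme, U)) :
    X.scheme.presheaf.germ U x hx b ∈ IsLocalRing.maximalIdeal (X.scheme.presheaf.stalk x) ↔
      b ∈ (hU.primeIdealOf ⟨x, hx⟩).asIdeal := by
  rw [IsLocalRing.mem_maximalIdeal, mem_nonunits_iff, isUnit_germ_iff hU, not_not]

theorem exists_germ_mul_eq_germ (z : X.scheme.presheaf.stalk x) :
    ∃ b ∉ (hU.primeIdealOf ⟨x, hx⟩).asIdeal, ∃ a,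
      X.scheme.presheaf.germ U x hx b * z = X.scheme.presheaf.germ U x hx a := by
  let _ := X.scheme.presheaf.algebra_section_stalk ⟨x, hx⟩
  have _ := hU.isLocalization_stalk ⟨x, hx⟩
  obtain ⟨⟨a, b⟩, h⟩ := IsLocalization.surj (hU.primeIdealOf ⟨x, hx⟩).asIdeal.primeCompl z
  exact ⟨b, b.2, a, (mul_comm _ _).trans h⟩

include hU in
theorem germ_injective_of_isDomain [IsDomain Γ(X.scheme, U)] :
    Function.Injective (X.scheme.presheaf.germ U x hx) := by
  let _ := X.scheme.presheaf.algebra_section_stalk ⟨x, hx⟩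
  have _ := hU.isLocalization_stalk ⟨x, hx⟩
  exact IsLocalization.injective (X.scheme.presheaf.stalk x)
    (hU.primeIdealOf ⟨x, hx⟩).asIdeal.primeCompl_le_nonZeroDivisors

end Affine

/-- An affine open subset of `X` with an integral coordinate ring. Being integral, it lies in a
single irreducible component of `X`, of which it contains the generic point. -/
structure Chart (X : ComplexVariety) where
  /-- the underlying open subset -/
  U : X.scheme.Opens
  isAffineOpen : IsAffineOpen U
  isDomain : IsDomain Γ(X.scheme, U)

namespace Chart

attribute [instance] Chart.isDomain

variable (V : X.Chart)

/-- The coordinate ring of a chart. -/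
abbrev Ring : Type := Γ(X.scheme, V.U)

/-- The prime ideal of a point of a chart. -/
noncomputable def prime (x : X.scheme) (hx : x ∈ V.U) : Ideal V.Ring :=
  (V.isAffineOpen.primeIdealOf ⟨x, hx⟩).asIdeal

instance (x : X.scheme) (hx : x ∈ V.U) : (V.prime x hx).IsPrime :=
  (V.isAffineOpen.primeIdealOf ⟨x, hx⟩).isPrime

/-- The point of a chart with a given prime ideal. -/
noncomputable def point (p : PrimeSpectrum V.Ring) : X.scheme :=
  V.isAffineOpen.fromSpec p

theorem isOpenEmbedding_point : Topology.IsOpenEmbedding V.point :=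
  V.isAffineOpen.fromSpec.isOpenEmbedding

theorem point_mem (p : PrimeSpectrum V.Ring) : V.point p ∈ V.U := by
  have : V.point p ∈ Set.range V.isAffineOpen.fromSpec := ⟨p, rfl⟩
  rwa [V.isAffineOpen.range_fromSpec] at this

theorem point_primeIdealOf (x : X.scheme) (hx : x ∈ V.U) :
    V.point (V.isAffineOpen.primeIdealOf ⟨x, hx⟩) = x :=
  V.isAffineOpen.fromSpec_primeIdealOf ⟨x, hx⟩

theorem prime_point (p : PrimeSpectrum V.Ring) :
    V.prime (V.point p) (V.point_mem p) = p.asIdeal := by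
  have := V.isOpenEmbedding_point.injective (V.point_primeIdealOf _ (V.point_mem p))
  exact congr($(this).asIdeal)

theorem eq_point (x : X.scheme) (hx : x ∈ V.U) : ∃ p : PrimeSpectrum V.Ring, x = V.point p :=
  ⟨_, (V.point_primeIdealOf x hx).symm⟩

theorem point_bot_specializes (x : X.scheme) (hx : x ∈ V.U) :
    V.point ⟨⊥, Ideal.isPrime_bot⟩ ⤳ x := by
  obtain ⟨p, rfl⟩ := V.eq_point x hx
  refine Specializes.map ?_ V.isOpenEmbedding_point.continuous
  rw [← PrimeSpectrum.le_iff_specializes]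
  exact bot_le (α := Ideal V.Ring)

theorem closure_point_bot_mem_irreducibleComponents :
    closure {V.point ⟨⊥, Ideal.isPrime_bot⟩} ∈ irreducibleComponents X.scheme := by
  refine ⟨isIrreducible_singleton.closure, fun Z hZ hle => ?_⟩
  have h1 : (V.U : Set X.scheme) ⊆ closure {V.point ⟨⊥, Ideal.isPrime_bot⟩} := fun x hx =>
    specializes_iff_mem_closure.mp (V.point_bot_specializes x hx)
  exact (subset_closure_inter_of_isPreirreducible_of_isOpen hZ.2 V.U.2
    ⟨_, hle (subset_closure rfl), V.point_mem _⟩).trans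
      (closure_minimal (Set.inter_subset_right.trans h1) isClosed_closure)

/-- The generic point of a chart. -/
noncomputable def generic : X.GenericPoint :=
  ⟨V.point ⟨⊥, Ideal.isPrime_bot⟩, V.closure_point_bot_mem_irreducibleComponents⟩

theorem generic_mem : V.generic.1 ∈ V.U := V.point_mem _

theorem generic_specializes (x : X.scheme) (hx : x ∈ V.U) : V.generic.1 ⤳ x :=
  V.point_bot_specializes x hx

theorem prime_generic : V.prime V.generic.1 V.generic_mem = ⊥ := V.prime_point _

theorem eq_generic (η : X.GenericPoint) (hη : η.1 ∈ V.U) : η = V.generic := by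
  have h : closure {η.1} ⊆ closure {V.generic.1} :=
    (V.generic_specializes _ hη).closure_subset
  have h' := η.2.eq_of_subset V.generic.2.1 h
  exact Subtype.ext ((inseparable_iff_closure_eq.mpr h').eq)

/-- The germ at the generic point of a chart. -/
noncomputable abbrev germ : V.Ring →ₐ[ℂ] X.scheme.presheaf.stalk V.generic.1 :=
  germAlgHom V.U V.generic.1 V.generic_mem

theorem germ_injective : Function.Injective V.germ :=
  germ_injective_of_isDomain V.isAffineOpen V.generic_mem

theorem isFractionRing :
    @IsFractionRing V.Ring _ (X.scheme.presheaf.stalk V.generic.1) _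
      V.germ.toRingHom.toAlgebra := by
  let _ := X.scheme.presheaf.algebra_section_stalk ⟨V.generic.1, V.generic_mem⟩
  have h := V.isAffineOpen.isLocalization_stalk ⟨V.generic.1, V.generic_mem⟩
  have h2 : (V.isAffineOpen.primeIdealOf ⟨V.generic.1, V.generic_mem⟩).asIdeal.primeCompl =
      nonZeroDivisors V.Ring := by
    have := V.prime_generic
    rw [prime] at this
    ext x
    rw [Ideal.mem_primeCompl_iff, this, mem_nonZeroDivisors_iff_ne_zero, Ideal.mem_bot]
  have h3 : IsLocalization
    (V.isAffineOpen.primeIdealOf ⟨V.generic.1, V.generic_mem⟩).asIdeal.primeCompl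
    (X.scheme.presheaf.stalk V.generic.1) := h
  rw [h2] at h3
  exact h3

/-- A chart contains only one generic point. -/
theorem isRepresentedBy_iff (f : X.RatFun) (a : V.Ring) :
    RatFun.IsRepresentedBy f V.U a ↔ V.germ a = f V.generic := by
  refine ⟨fun h => h _ V.generic_mem, fun h η hη => ?_⟩
  obtain rfl := V.eq_generic η hη
  exact h

/-- If `f` is represented near `x` by a regular function whose germ at `x` is the quotient of two
functions on the chart, then `f` is that quotient as a rational function. -/
theorem germ_mul_eq_of_isRepresentedBy {f : X.RatFun} {U : X.scheme.Opens} {s : Γ(X.scheme, U)}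
    (hf : RatFun.IsRepresentedBy f U s) {x : X.scheme} (hxU : x ∈ U) (hx : x ∈ V.U) {a b : V.Ring}
    (h : X.scheme.presheaf.germ V.U x hx b * X.scheme.presheaf.germ U x hxU s =
      X.scheme.presheaf.germ V.U x hx a) :
    V.germ b * f V.generic = V.germ a := by
  have hsp := V.generic_specializes x hx
  have hη : V.generic.1 ∈ U := hsp.mem_open U.2 hxU
  have h1 := congr(X.scheme.presheaf.stalkSpecializes hsp $h)
  rw [map_mul, TopCat.Presheaf.germ_stalkSpecializes_apply,
    TopCat.Presheaf.germ_stalkSpecializes_apply,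
    TopCat.Presheaf.germ_stalkSpecializes_apply, hf _ hη] at h1
  exact h1

/-- A rational function that is regular at `x` is on a chart a quotient with a denominator that does
not vanish at `x`. -/
theorem exists_denominator_of_isRegularAt {f : X.RatFun} {x : X.scheme} (hx : x ∈ V.U)
    (hf : RatFun.IsRegularAt f x) :
    ∃ b ∉ V.prime x hx, ∃ a, V.germ b * f V.generic = V.germ a := by
  obtain ⟨U, s, hxU, hs⟩ := hf
  obtain ⟨b, hb, a, h⟩ := exists_germ_mul_eq_germ V.isAffineOpen hx
    (X.scheme.presheaf.germ U x hxU s)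
  exact ⟨b, hb, a, V.germ_mul_eq_of_isRepresentedBy hs hxU hx h⟩

theorem isRegularAt {f : X.RatFun} {x : X.scheme} (hx : x ∈ V.U) {a : V.Ring}
    (h : V.germ a = f V.generic) : RatFun.IsRegularAt f x :=
  ⟨V.U, a, hx, (V.isRepresentedBy_iff f a).mpr h⟩

/-- The vanishing of a regular function on a chart does not depend on the function that represents
it near `x`, because the local ring at `x` embeds into the one at the generic point. -/
theorem vanishesAt_iff {f : X.RatFun} {x : X.scheme} (hx : x ∈ V.U) {a : V.Ring}
    (h : V.germ a = f V.generic) : RatFun.VanishesAt f x ↔ a ∈ V.prime x hx := by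
  constructor
  · rintro ⟨U, s, hxU, hs, h0⟩
    obtain ⟨b, hb, c, hbc⟩ := exists_germ_mul_eq_germ V.isAffineOpen hx
      (X.scheme.presheaf.germ U x hxU s)
    have h1 := V.germ_mul_eq_of_isRepresentedBy hs hxU hx hbc
    rw [← h, ← map_mul] at h1
    have h2 := V.germ_injective h1
    have h3 : X.scheme.presheaf.germ U x hxU s ∈
        IsLocalRing.maximalIdeal (X.scheme.presheaf.stalk x) := by
      rw [← IsLocalRing.residue_eq_zero_iff]
      exact h0
    have h4 : c ∈ V.prime x hx := by
      rw [prime, ← germ_mem_maximalIdeal_iff V.isAffineOpen hx, ← hbc]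
      exact Ideal.mul_mem_left _ _ h3
    rw [← h2] at h4
    exact (Ideal.IsPrime.mem_or_mem inferInstance h4).resolve_left hb
  · intro ha
    refine ⟨V.U, a, hx, (V.isRepresentedBy_iff f a).mpr h, ?_⟩
    have := (germ_mem_maximalIdeal_iff V.isAffineOpen hx a).mpr ha
    rw [← IsLocalRing.residue_eq_zero_iff] at this
    exact this

end Chart

end ComplexVariety

/-! ### Dimension of charts and of closed subsets -/

namespace ComplexVariety

variable {X : ComplexVariety}

/-- The dimension of an irreducible closed set is attained in some affine open set. -/
theorem exists_isAffineOpen_le_ringKrullDim {η : X.scheme} {n : ℕ}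
    (h : n ≤ topologicalKrullDim (closure {η})) :
    ∃ (W : X.scheme.Opens) (hW : IsAffineOpen W) (hη : η ∈ W),
      n ≤ ringKrullDim (Γ(X.scheme, W) ⧸ (hW.primeIdealOf ⟨η, hη⟩).asIdeal) := by
  obtain ⟨l, hl⟩ := Order.le_krullDim_iff.mp h
  -- an affine neighbourhood of a point of the smallest member of a chain of maximal length
  obtain ⟨z, hz⟩ := l.head.isIrreducible.nonempty
  obtain ⟨_, ⟨W, hW, rfl⟩, hzW, -⟩ :=
    X.scheme.isBasis_affineOpens.exists_subset_of_mem_open (Set.mem_univ z.1) isOpen_univ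
  have hη : η ∈ W := (specializes_iff_mem_closure.mpr z.2).mem_open W.2 hzW
  refine ⟨W, hW, hη, ?_⟩
  have h1 : (n : WithBot ℕ∞) ≤ Order.krullDim (Set.Ici l.head) := by
    rw [← Order.coheight_eq_krullDim_Ici, ← hl]
    exact_mod_cast Order.length_le_coheight_head (p := l)
  refine h1.trans ?_
  rw [ringKrullDim_quotient, ← Order.krullDim_orderDual (α := PrimeSpectrum.zeroLocus _)]
  -- the generic points of the members of the chain
  let Y : TopologicalSpace.IrreducibleCloseds (closure {η}) → Set X.scheme :=
    fun T => Subtype.val '' (T : Set (closure {η}))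
  have hYc : ∀ T, IsClosed (Y T) := fun T =>
    isClosed_closure.isClosedEmbedding_subtypeVal.isClosedMap _ T.isClosed
  have hYi : ∀ T, IsIrreducible (Y T) := fun T =>
    T.isIrreducible.image _ continuous_subtype_val.continuousOn
  let ζ := fun T => (hYi T).genericPoint
  have hζ : ∀ T, IsGenericPoint (ζ T) (Y T) := fun T =>
    (hYi T).isGenericPoint_genericPoint (hYc T)
  have hζW : ∀ T, l.head ≤ T → ζ T ∈ W := fun T hT =>
    ((hζ T).specializes (Set.mem_image_of_mem _ (hT hz))).mem_open W.2 hzW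
  have hle : ∀ {x y : X.scheme} (hx : x ∈ W) (hy : y ∈ W), x ⤳ y →
      (hW.primeIdealOf ⟨x, hx⟩) ≤ hW.primeIdealOf ⟨y, hy⟩ := by
    intro x y hx hy hxy
    rw [PrimeSpectrum.le_iff_specializes]
    refine Specializes.map ?_ hW.isoSpec.hom.continuous
    exact Topology.IsInducing.subtypeVal.specializes_iff.mp hxy
  let F : Set.Ici l.head → (PrimeSpectrum.zeroLocus
      ((hW.primeIdealOf ⟨η, hη⟩).asIdeal : Set Γ(X.scheme, W)))ᵒᵈ := fun T =>
    OrderDual.toDual ⟨hW.primeIdealOf ⟨ζ T.1, hζW T.1 T.2⟩, hle _ _ <| by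
      have : ζ T.1 ∈ Y T.1 := (hζ T.1).mem
      obtain ⟨y, -, hy⟩ := this
      exact specializes_iff_mem_closure.mpr (hy ▸ y.2)⟩
  have hF : StrictMono F := by
    intro T T' hTT'
    have hsp : ζ T'.1 ⤳ ζ T.1 :=
      (hζ T'.1).specializes (Set.image_mono hTT'.le (hζ T.1).mem)
    refine lt_of_le_of_ne (hle (hζW T'.1 T'.2) (hζW T.1 T.2) hsp) fun heq => hTT'.ne ?_
    have h2 : hW.primeIdealOf ⟨ζ T.1, hζW T.1 T.2⟩ = hW.primeIdealOf ⟨ζ T'.1, hζW T'.1 T'.2⟩ :=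
      congr((OrderDual.ofDual $heq).1)
    have h3 : ζ T.1 = ζ T'.1 := by
      have := congr(hW.fromSpec $h2)
      rwa [hW.fromSpec_primeIdealOf, hW.fromSpec_primeIdealOf] at this
    have h4 : Y T.1 = Y T'.1 := by rw [← (hζ T.1).def, ← (hζ T'.1).def, h3]
    exact Subtype.ext (TopologicalSpace.IrreducibleCloseds.ext
      (Subtype.val_injective.image_injective h4))
  exact Order.krullDim_le_of_strictMono F hF

theorem Chart.exists_ringKrullDim_eq (V : X.Chart) : ∃ s : ℕ, ringKrullDim V.Ring = s ∧
    (∀ m : Ideal V.Ring, m.IsMaximal → m.height = s) ∧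
    Algebra.trdeg ℂ (X.scheme.presheaf.stalk V.generic.1) = s := by
  have _ := finiteType_section V.isAffineOpen
  obtain ⟨s, h1, h2, h3⟩ := exists_height_eq_ringKrullDim_trdeg (k := ℂ) (A := V.Ring)
  refine ⟨s, h1, h2, ?_⟩
  let _ : Algebra V.Ring (X.scheme.presheaf.stalk V.generic.1) := V.germ.toRingHom.toAlgebra
  have _ : IsFractionRing V.Ring (X.scheme.presheaf.stalk V.generic.1) := V.isFractionRing
  have _ : IsScalarTower ℂ V.Ring (X.scheme.presheaf.stalk V.generic.1) :=
    IsScalarTower.of_algebraMap_eq fun c => (V.germ.commutes c).symm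
  have _ : IsDomain (X.scheme.presheaf.stalk V.generic.1) := IsFractionRing.isDomain V.Ring
  have _ : FaithfulSMul V.Ring (X.scheme.presheaf.stalk V.generic.1) :=
    (faithfulSMul_iff_algebraMap_injective _ _).mpr V.germ_injective
  have _ : Algebra.IsAlgebraic V.Ring (X.scheme.presheaf.stalk V.generic.1) :=
    IsLocalization.isAlgebraic _ (nonZeroDivisors V.Ring)
  rw [← trdeg_add_eq ℂ V.Ring, h3, trdeg_eq_zero (R := V.Ring)
    (A := X.scheme.presheaf.stalk V.generic.1), add_zero]

/-- All charts of an equidimensional variety have its dimension. A chart is a subspace of a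
component; conversely the dimension of the component is attained in an affine open set `W`, and
does not exceed the transcendence degree of the function field, which the chart computes. -/
theorem Chart.ringKrullDim_and_height_eq (V : X.Chart) {n : ℕ} (hX : X.IsEquidimensional n) :
    ringKrullDim V.Ring = n ∧ ∀ m : Ideal V.Ring, m.IsMaximal → m.height = n := by
  obtain ⟨s, h1, h2, h3⟩ := V.exists_ringKrullDim_eq
  have hdim := hX _ V.generic.2
  suffices s = n by subst this; exact ⟨h1, h2⟩
  apply le_antisymm
  · -- the chart is a subspace of the component
    let j : PrimeSpectrum V.Ring → closure {V.generic.1} := fun p =>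
      ⟨V.point p, specializes_iff_mem_closure.mp (V.generic_specializes _ (V.point_mem p))⟩
    have hj : Topology.IsInducing j := by
      refine Topology.IsInducing.of_comp ?_ continuous_subtype_val ?_
      · exact V.isOpenEmbedding_point.continuous.subtype_mk _
      · exact V.isOpenEmbedding_point.isInducing
    have := hj.topologicalKrullDim_le
    rw [PrimeSpectrum.topologicalKrullDim_eq_ringKrullDim, h1, hdim] at this
    exact_mod_cast this
  · obtain ⟨W, hW, hη, hn⟩ := exists_isAffineOpen_le_ringKrullDim hdim.ge
    let p := (hW.primeIdealOf ⟨V.generic.1, hη⟩).asIdeal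
    have _ := finiteType_section hW
    obtain ⟨t, ht, -, ht'⟩ := exists_height_eq_ringKrullDim_trdeg (k := ℂ) (A := Γ(X.scheme, W) ⧸ p)
    let _ : Algebra V.Ring (X.scheme.presheaf.stalk V.generic.1) := V.germ.toRingHom.toAlgebra
    have _ : IsFractionRing V.Ring (X.scheme.presheaf.stalk V.generic.1) := V.isFractionRing
    have hfield : IsField (X.scheme.presheaf.stalk V.generic.1) :=
      (IsFractionRing.toField V.Ring).toIsField
    have hker : ∀ a : Γ(X.scheme, W), germAlgHom W V.generic.1 hη a = 0 ↔ a ∈ p := by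
      intro a
      rw [← germ_mem_maximalIdeal_iff hW hη, IsLocalRing.isField_iff_maximalIdeal_eq.mp hfield]
      exact Iff.rfl
    let g : Γ(X.scheme, W) ⧸ p →ₐ[ℂ] X.scheme.presheaf.stalk V.generic.1 :=
      Ideal.Quotient.liftₐ p (germAlgHom W V.generic.1 hη) fun a ha => (hker a).mpr ha
    have hg : Function.Injective g := by
      rw [injective_iff_map_eq_zero]
      intro a
      obtain ⟨a, rfl⟩ := Ideal.Quotient.mk_surjective a
      intro h
      exact Ideal.Quotient.eq_zero_iff_mem.mpr ((hker a).mp h)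
    have := trdeg_le_of_injective g hg
    rw [h3, ht'] at this
    rw [ht] at hn
    have h5 : t ≤ s := by exact_mod_cast this
    have h6 : n ≤ t := by exact_mod_cast hn
    omega

/-- The closed sets of smaller dimension are the nowhere dense ones. -/
theorem topologicalKrullDim_lt_iff {n : ℕ} (hX : X.IsEquidimensional n) {S : Set X.scheme}
    (hS : IsClosed S) : topologicalKrullDim S < n ↔ ∀ η : X.GenericPoint, η.1 ∉ S := by
  constructor
  · intro h η hη
    have hle : closure {η.1} ⊆ S := closure_minimal (Set.singleton_subset_iff.mpr hη) hS
    have : topologicalKrullDim (closure {η.1}) ≤ topologicalKrullDim S :=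
      (Topology.IsEmbedding.inclusion hle).isInducing.topologicalKrullDim_le
    rw [hX _ η.2] at this
    exact absurd h this.not_gt
  · intro h
    by_contra! hcon
    obtain ⟨l, hl⟩ := Order.le_krullDim_iff.mp hcon
    -- a chain in `S` can be extended by an irreducible component `C`
    let M := TopologicalSpace.IrreducibleCloseds.map Subtype.val
      (continuous_subtype_val (p := (· ∈ S)))
    have hM : StrictMono M :=
      TopologicalSpace.IrreducibleCloseds.map_strictMono_of_isInducing
        Topology.IsInducing.subtypeVal
    obtain ⟨C, hC, hlC⟩ := exists_mem_irreducibleComponents_subset_of_isIrreducible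
      (M l.last : Set X.scheme) (M l.last).isIrreducible
    have hCc := isClosed_of_mem_irreducibleComponents C hC
    let C' : TopologicalSpace.IrreducibleCloseds X.scheme := ⟨C, hC.1, hCc⟩
    have hMS : (M l.last : Set X.scheme) ⊆ S :=
      closure_minimal (by rintro _ ⟨x, -, rfl⟩; exact x.2) hS
    have hlt : M l.last < C' := by
      refine lt_of_le_of_ne hlC fun heq => ?_
      have hg := hC.1.isGenericPoint_genericPoint hCc
      refine h ⟨hC.1.genericPoint, hg.def.symm ▸ hC⟩ (hMS ?_)
      rw [heq]
      exact hg.mem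
    have h1 : (n : ℕ∞) ≤ Order.height (M l.last) := by
      have := Order.length_le_height_last (p := l.map M hM)
      rwa [LTSeries.last_map, LTSeries.map_length, hl] at this
    have h2 : (n : ℕ∞) + 1 ≤ Order.height C' :=
      (add_le_add_left h1 1).trans (Order.height_add_one_le hlt)
    have h3 : Order.krullDim (Set.Iic C') ≤ topologicalKrullDim C := by
      let ζ : Set.Iic C' → C := fun T => ⟨T.1.isIrreducible.genericPoint,
        T.2 (T.1.isIrreducible.isGenericPoint_genericPoint T.1.isClosed).mem⟩
      have hζ : ∀ T, IsGenericPoint (ζ T).1 (T.1 : Set X.scheme) := fun T =>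
        T.1.isIrreducible.isGenericPoint_genericPoint T.1.isClosed
      refine Order.krullDim_le_of_strictMono
        (fun T => (⟨closure {ζ T}, isIrreducible_singleton.closure, isClosed_closure⟩ :
          TopologicalSpace.IrreducibleCloseds C)) ?_
      refine Monotone.strictMono_of_injective ?_ ?_
      · intro T T' hT
        have : ζ T' ⤳ ζ T := by
          rw [← Topology.IsInducing.subtypeVal.specializes_iff]
          exact (hζ T').specializes (hT (hζ T).mem)
        exact this.closure_subset
      · intro T T' heq
        have h4 : closure {ζ T} = closure {ζ T'} := congr(($heq : Set C))
        have h5 : ζ T = ζ T' := (inseparable_iff_closure_eq.mpr h4).eq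
        refine Subtype.ext (TopologicalSpace.IrreducibleCloseds.ext ?_)
        rw [← (hζ T).def, ← (hζ T').def, h5]
    rw [hX C hC, ← Order.height_eq_krullDim_Iic] at h3
    have h4 : Order.height C' ≤ n := by exact_mod_cast h3
    have h5 : n + 1 ≤ n := by exact_mod_cast h2.trans h4
    omega

end ComplexVariety

/-! ### Complex points and the diagonal -/

/-- A `k`-algebra homomorphism to `k` is determined by its kernel. -/
theorem AlgHom.eq_of_ker_eq {k A : Type*} [Field k] [CommRing A] [Algebra k A] {φ ψ : A →ₐ[k] k}
    (h : RingHom.ker φ = RingHom.ker ψ) : φ = ψ := by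
  ext a
  have h1 : a - algebraMap k A (φ a) ∈ RingHom.ker φ := by simp [RingHom.mem_ker]
  rw [h, RingHom.mem_ker, map_sub, AlgHom.commutes, sub_eq_zero] at h1
  exact h1.symm

namespace ComplexVariety

variable {X : ComplexVariety}

namespace Chart

variable (V V' : X.Chart)

theorem fromSpec_comp_str : V.isAffineOpen.fromSpec ≫ X.str =
    Spec.map (CommRingCat.ofHom (algebraMap ℂ V.Ring)) := by
  rw [← IsAffineOpen.SpecMap_appLE_fromSpec X.str (isAffineOpen_top _) V.isAffineOpen le_top,
    IsAffineOpen.fromSpec_top, Scheme.isoSpec_Spec_inv, ← Spec.map_comp]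
  rfl

/-- The complex point of a chart given by a homomorphism of its coordinate ring. -/
noncomputable def homPoint (φ : V.Ring →ₐ[ℂ] ℂ) : X.scheme :=
  V.point ⟨RingHom.ker φ, RingHom.ker_isPrime _⟩

theorem homPoint_mem (φ : V.Ring →ₐ[ℂ] ℂ) : V.homPoint φ ∈ V.U := V.point_mem _

theorem homPoint_injective : Function.Injective V.homPoint := fun _ _ h =>
  AlgHom.eq_of_ker_eq congr($(V.isOpenEmbedding_point.injective h).asIdeal)

theorem prime_homPoint (φ : V.Ring →ₐ[ℂ] ℂ) :
    V.prime (V.homPoint φ) (V.homPoint_mem φ) = RingHom.ker φ := V.prime_point _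

theorem isMaximal_ker (φ : V.Ring →ₐ[ℂ] ℂ) : (RingHom.ker φ).IsMaximal :=
  RingHom.ker_isMaximal_of_surjective φ fun c => ⟨algebraMap ℂ V.Ring c, φ.commutes c⟩

theorem isClosed_homPoint (φ : V.Ring →ₐ[ℂ] ℂ) : IsClosed {V.homPoint φ} := by
  have h := V.isOpenEmbedding_point.preimage_closedPoints
  have h1 : (⟨RingHom.ker φ, RingHom.ker_isPrime _⟩ : PrimeSpectrum V.Ring) ∈
      closedPoints (PrimeSpectrum V.Ring) := by
    rw [mem_closedPoints_iff, PrimeSpectrum.isClosed_singleton_iff_isMaximal]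
    exact V.isMaximal_ker φ
  rw [← h] at h1
  exact h1

theorem exists_homPoint_eq {x : X.scheme} (hx : x ∈ V.U) (hc : IsClosed {x}) :
    ∃ φ : V.Ring →ₐ[ℂ] ℂ, V.homPoint φ = x := by
  have hm : (V.prime x hx).IsMaximal :=
    V.isAffineOpen.primeIdealOf_isMaximal_of_isClosed ⟨x, hx⟩ hc
  have _ := finiteType_section V.isAffineOpen
  obtain ⟨φ, hφ, -⟩ := exists_algHom_of_notMem (k := ℂ) (V.prime x hx) (b := 1)
    ((Ideal.ne_top_iff_one _).mp hm.ne_top)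
  have heq : V.prime x hx = RingHom.ker φ := hm.eq_of_le (RingHom.ker_isPrime φ).ne_top hφ
  refine ⟨φ, ?_⟩
  rw [← V.point_primeIdealOf x hx, homPoint]
  exact congrArg V.point (PrimeSpectrum.ext heq.symm)

theorem vanishesAt_homPoint_iff {f : X.RatFun} {a : V.Ring} (h : V.germ a = f V.generic)
    (φ : V.Ring →ₐ[ℂ] ℂ) : RatFun.VanishesAt f (V.homPoint φ) ↔ φ a = 0 := by
  rw [V.vanishesAt_iff (V.homPoint_mem φ) h, prime_homPoint, RingHom.mem_ker]

/-- A complex point of a chart as a morphism. -/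
noncomputable def homMorphism (φ : V.Ring →ₐ[ℂ] ℂ) : Spec (CommRingCat.of ℂ) ⟶ X.scheme :=
  Spec.map (CommRingCat.ofHom φ.toRingHom) ≫ V.isAffineOpen.fromSpec

theorem homMorphism_comp_str (φ : V.Ring →ₐ[ℂ] ℂ) : V.homMorphism φ ≫ X.str = 𝟙 _ := by
  rw [homMorphism, Category.assoc, fromSpec_comp_str, ← Spec.map_comp, ← CommRingCat.ofHom_comp]
  have : φ.toRingHom.comp (algebraMap ℂ V.Ring) = RingHom.id ℂ := by
    ext c; exact φ.commutes c
  change Spec.map (CommRingCat.ofHom (φ.toRingHom.comp (algebraMap ℂ V.Ring))) = _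
  rw [this]
  exact Spec.map_id _

theorem homMorphism_apply (φ : V.Ring →ₐ[ℂ] ℂ) :
    V.homMorphism φ (IsLocalRing.closedPoint ℂ) = V.homPoint φ := by
  refine (Scheme.Hom.comp_apply _ _ _).trans ?_
  refine congrArg V.isAffineOpen.fromSpec (PrimeSpectrum.ext ?_)
  change (IsLocalRing.maximalIdeal ℂ).comap φ.toRingHom = RingHom.ker φ
  rw [IsLocalRing.maximalIdeal_eq_bot]
  rfl

open TensorProduct in
/-- On a product of two charts, the diagonal is defined by an ideal: as `X` is separated, the
equalizer of the two projections to `X` is a closed subscheme of the product. -/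
theorem exists_ideal_diagonal : ∃ I : Ideal (V.Ring ⊗[ℂ] V'.Ring),
    ∀ (φ : V.Ring →ₐ[ℂ] ℂ) (ψ : V'.Ring →ₐ[ℂ] ℂ), V.homPoint φ = V'.homPoint ψ ↔
      ∀ a ∈ I, Algebra.TensorProduct.lift φ ψ (fun _ _ => .all _ _) a = 0 := by
  let C := V.Ring ⊗[ℂ] V'.Ring
  let iL : V.Ring →ₐ[ℂ] C := Algebra.TensorProduct.includeLeft
  let iR : V'.Ring →ₐ[ℂ] C := Algebra.TensorProduct.includeRight
  let S : Over (Spec (CommRingCat.of ℂ)) := Over.mk (Spec.map (CommRingCat.ofHom (algebraMap ℂ C)))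
  let Y : Over (Spec (CommRingCat.of ℂ)) := Over.mk X.str
  let uL : Spec (CommRingCat.of C) ⟶ X.scheme :=
    Spec.map (CommRingCat.ofHom iL.toRingHom) ≫ V.isAffineOpen.fromSpec
  let uR : Spec (CommRingCat.of C) ⟶ X.scheme :=
    Spec.map (CommRingCat.ofHom iR.toRingHom) ≫ V'.isAffineOpen.fromSpec
  have hL : uL ≫ X.str = Spec.map (CommRingCat.ofHom (algebraMap ℂ C)) := by
    rw [Category.assoc, fromSpec_comp_str, ← Spec.map_comp, ← CommRingCat.ofHom_comp]
    congr 2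
  have hR : uR ≫ X.str = Spec.map (CommRingCat.ofHom (algebraMap ℂ C)) := by
    rw [Category.assoc, fromSpec_comp_str, ← Spec.map_comp, ← CommRingCat.ofHom_comp]
    exact congr(Spec.map (CommRingCat.ofHom $(iR.comp_algebraMap)))
  let gL : S ⟶ Y := Over.homMk uL hL
  let gR : S ⟶ Y := Over.homMk uR hR
  have _ : IsSeparated Y.hom := X.separated
  have hι : IsClosedImmersion (Limits.equalizer.ι gL gR).left := inferInstance
  obtain ⟨I, e, he⟩ := (IsClosedImmersion.Spec_iff (R := CommRingCat.of C)).mp hι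
  have hcond : Spec.map (CommRingCat.ofHom (Ideal.Quotient.mk I)) ≫ uL =
      Spec.map (CommRingCat.ofHom (Ideal.Quotient.mk I)) ≫ uR := by
    have h1 : (Limits.equalizer.ι gL gR).left ≫ uL = (Limits.equalizer.ι gL gR).left ≫ uR :=
      congr(($(Limits.equalizer.condition gL gR)).left)
    rw [he, Category.assoc, Category.assoc] at h1
    exact (cancel_epi e.hom).mp h1
  refine ⟨I, fun φ ψ => ?_⟩
  let χ : C →ₐ[ℂ] ℂ := Algebra.TensorProduct.lift φ ψ (fun _ _ => .all _ _)
  let y : Spec (CommRingCat.of ℂ) ⟶ Spec (CommRingCat.of C) :=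
    Spec.map (CommRingCat.ofHom χ.toRingHom)
  have hyL : y ≫ uL = V.homMorphism φ := by
    have : χ.toRingHom.comp iL.toRingHom = φ.toRingHom := by
      ext a
      change Algebra.TensorProduct.lift φ ψ (fun _ _ => .all _ _) (a ⊗ₜ[ℂ] (1 : V'.Ring)) = φ a
      rw [Algebra.TensorProduct.lift_tmul, map_one, mul_one]
    rw [homMorphism, ← this, CommRingCat.ofHom_comp, Spec.map_comp, Category.assoc]
  have hyR : y ≫ uR = V'.homMorphism ψ := by
    have : χ.toRingHom.comp iR.toRingHom = ψ.toRingHom := by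
      ext a
      change Algebra.TensorProduct.lift φ ψ (fun _ _ => .all _ _) ((1 : V.Ring) ⊗ₜ[ℂ] a) = ψ a
      rw [Algebra.TensorProduct.lift_tmul, map_one, one_mul]
    rw [homMorphism, ← this, CommRingCat.ofHom_comp, Spec.map_comp, Category.assoc]
  constructor
  · intro h a ha
    have h1 : V.homMorphism φ = V'.homMorphism ψ :=
      ext_of_apply_closedPoint_eq X.str (V.homMorphism_comp_str φ) (V'.homMorphism_comp_str ψ)
        (by rw [homMorphism_apply, homMorphism_apply, h])
    let y' : Over.mk (𝟙 (Spec (CommRingCat.of ℂ))) ⟶ S := Over.homMk y <| by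
      change y ≫ Spec.map _ = 𝟙 _
      rw [← hL, ← Category.assoc, hyL, homMorphism_comp_str]
    have h2 : y' ≫ gL = y' ≫ gR := by
      ext1
      change y ≫ uL = y ≫ uR
      rw [hyL, hyR, h1]
    let z := (Limits.equalizer.lift y' h2).left
    have h3 : z ≫ (Limits.equalizer.ι gL gR).left = y :=
      congr(($(Limits.equalizer.lift_ι y' h2)).left)
    rw [he] at h3
    have h4 : CommRingCat.ofHom χ.toRingHom =
        CommRingCat.ofHom (Ideal.Quotient.mk I) ≫ Spec.preimage (z ≫ e.hom) := by
      apply Spec.map_injective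
      rw [Spec.map_comp, Spec.map_preimage, Category.assoc, h3]
    have h5 := congr($h4 a)
    change χ a = (Spec.preimage (z ≫ e.hom)).hom (Ideal.Quotient.mk I a) at h5
    rw [Ideal.Quotient.eq_zero_iff_mem.mpr ha, map_zero] at h5
    exact h5
  · intro h
    let χ' : C ⧸ I →+* ℂ := Ideal.Quotient.lift I χ.toRingHom h
    have h1 : y = Spec.map (CommRingCat.ofHom χ') ≫
        Spec.map (CommRingCat.ofHom (Ideal.Quotient.mk I)) := by
      rw [← Spec.map_comp, ← CommRingCat.ofHom_comp]
      congr 2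
    have h2 : V.homMorphism φ = V'.homMorphism ψ := by
      rw [← hyL, ← hyR, h1, Category.assoc, hcond, Category.assoc]
    rw [← homMorphism_apply, h2, homMorphism_apply]

end Chart

end ComplexVariety

/-! ### Admissible sets -/

namespace ComplexVariety

variable {X : ComplexVariety}

instance isNoetherian (X : ComplexVariety) : IsNoetherian X.scheme where

/-- A dense open set contains all generic points. -/
theorem GenericPoint.mem_of_dense (η : X.GenericPoint) {U : Set X.scheme} (hU : IsOpen U)
    (hd : Dense U) : η.1 ∈ U := by
  have hfin := TopologicalSpace.NoetherianSpace.finite_irreducibleComponents (α := X.scheme)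
  let O : Set X.scheme := (⋃₀ (irreducibleComponents X.scheme \ {closure {η.1}}))ᶜ
  have hO : IsOpen O := by
    rw [isOpen_compl_iff, Set.sUnion_eq_biUnion]
    exact hfin.sdiff.isClosed_biUnion fun W hW => isClosed_of_mem_irreducibleComponents W hW.1
  have hcl : closure O = closure {η.1} :=
    closure_sUnion_irreducibleComponents_sdiff_singleton hfin _ η.2
  have hne : O.Nonempty := by
    rw [← closure_nonempty_iff, hcl]
    exact ⟨η.1, subset_closure rfl⟩
  obtain ⟨y, hyO, hyU⟩ := hd.inter_open_nonempty O hO hne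
  have hy : y ∈ closure {η.1} := hcl ▸ subset_closure hyO
  exact (specializes_iff_mem_closure.mpr hy).mem_open hU hyU

theorem GenericPoint.mem_smoothLocus (η : X.GenericPoint) : η.1 ∈ X.str.smoothLocus :=
  η.mem_of_dense X.str.smoothLocus.2 (X.str.dense_smoothLocus_of_perfectField)

/-- A smooth point has arbitrarily small charts. -/
theorem exists_chart {x : X.scheme} (hx : x ∈ X.str.smoothLocus) (W : X.scheme.Opens)
    (hW : x ∈ W) : ∃ V : X.Chart, x ∈ V.U ∧ V.U ≤ W := by
  have _ := (isDomain_and_isIntegrallyClosed_stalk hx).1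
  obtain ⟨V, hxV, hV, hVW, hd⟩ := exists_isAffineOpen_isDomain x W hW
  exact ⟨⟨V, hV, hd⟩, hxV, hVW⟩

/-- On some neighbourhood of a generic point, all functions of `L` are regular and one of them has
no zeros. -/
theorem KRat.exists_chart_regular (L : X.KRat) (η : X.GenericPoint) :
    ∃ (V : X.Chart) (h : η.1 ∈ V.U),
      (∀ f ∈ L.space, ∃ a, X.scheme.presheaf.germ V.U η.1 h a = f η) ∧
      ∃ f ∈ L.space, ∃ a, IsUnit a ∧ X.scheme.presheaf.germ V.U η.1 h a = f η := by
  classical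
  obtain ⟨V, hηV, -⟩ := exists_chart η.mem_smoothLocus ⊤ trivial
  obtain rfl := V.eq_generic η hηV
  let g := X.scheme.presheaf.germ V.U V.generic.1 hηV
  have hginj : Function.Injective g := germ_injective_of_isDomain V.isAffineOpen hηV
  have hfield : IsField (X.scheme.presheaf.stalk V.generic.1) := by
    let _ : Algebra V.Ring (X.scheme.presheaf.stalk V.generic.1) := V.germ.toRingHom.toAlgebra
    have _ : IsFractionRing V.Ring (X.scheme.presheaf.stalk V.generic.1) := V.isFractionRing
    exact (IsFractionRing.toField V.Ring).toIsField
  have _ : IsDomain (X.scheme.presheaf.stalk V.generic.1) := hfield.isDomain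
  have hunit : ∀ z : X.scheme.presheaf.stalk V.generic.1, z ≠ 0 → IsUnit z := fun z hz =>
    let ⟨w, hw⟩ := hfield.mul_inv_cancel hz
    IsUnit.of_mul_eq_one w hw
  -- a common denominator
  obtain ⟨b, hb, hbL⟩ : ∃ b, IsUnit (g b) ∧ ∀ f ∈ L.space, ∃ a, g b * f V.generic = g a := by
    have _ := L.finiteDimensional
    obtain ⟨s, hs⟩ := Module.Finite.iff_fg.mp L.finiteDimensional
    choose b hb a ha using fun f : X.RatFun =>
      exists_germ_mul_eq_germ V.isAffineOpen hηV (f V.generic)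
    refine ⟨∏ f ∈ s, b f, ?_, fun f hf => ?_⟩
    · rw [isUnit_germ_iff V.isAffineOpen hηV]
      intro h
      obtain ⟨f, -, h⟩ := (Ideal.IsPrime.prod_mem_iff
        (hp := (V.isAffineOpen.primeIdealOf ⟨_, hηV⟩).isPrime)).mp h
      exact hb f h
    · rw [← hs] at hf
      induction hf using Submodule.span_induction with
      | mem f hf =>
        refine ⟨(∏ f' ∈ s.erase f, b f') * a f, ?_⟩
        rw [← Finset.prod_erase_mul s b hf, map_mul, mul_assoc, ha f, map_mul]
      | zero => exact ⟨0, by simp⟩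
      | add f f' _ _ hf hf' =>
        obtain ⟨c, hc⟩ := hf
        obtain ⟨c', hc'⟩ := hf'
        exact ⟨c + c', by rw [Pi.add_apply, mul_add, hc, hc', map_add]⟩
      | smul r f _ hf =>
        obtain ⟨c, hc⟩ := hf
        refine ⟨algebraMap ℂ _ r * c, ?_⟩
        rw [Pi.smul_apply, Algebra.smul_def, mul_left_comm, hc, map_mul, ← germ_algebraMap]
  obtain ⟨f₀, hf₀L, hf₀⟩ : ∃ f ∈ L.space, f V.generic ≠ 0 := by
    by_contra! h
    refine L.restrict_ne_bot V.generic ?_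
    rw [eq_bot_iff]
    rintro _ ⟨f, hf, rfl⟩
    exact h f hf
  obtain ⟨a₀, ha₀⟩ := hbL f₀ hf₀L
  have ha₀u : IsUnit (g a₀) := by
    rw [← ha₀]
    exact hb.mul (hunit _ hf₀)
  -- the complement of the denominator and of the zeros of `f₀`
  let c := b * a₀
  have hc : V.generic.1 ∈ X.scheme.basicOpen c := by
    rw [X.scheme.mem_basicOpen c V.generic.1 hηV, map_mul]
    exact hb.mul ha₀u
  have hinj := injective_germ_basicOpen V.U V.isAffineOpen _ hηV c hc hginj
  let V' : X.Chart := ⟨X.scheme.basicOpen c, V.isAffineOpen.basicOpen c,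
    hinj.isDomain (X.scheme.presheaf.germ _ _ hc).hom⟩
  let res : V.Ring →+* V'.Ring := (X.scheme.presheaf.map (homOfLE (X.scheme.basicOpen_le c)).op).hom
  have hres : ∀ a, X.scheme.presheaf.germ V'.U V.generic.1 hc (res a) = g a := fun a =>
    TopCat.Presheaf.germ_res_apply _ _ _ _ _
  have hcu : IsUnit (res c) := RingedSpace.isUnit_res_basicOpen _ c
  have hcu' : IsUnit (res b * res a₀) := by rwa [← map_mul]
  obtain ⟨u, hu⟩ := isUnit_of_mul_isUnit_left hcu'
  have hdiv : ∀ f : X.RatFun, ∀ a, g b * f V.generic = g a →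
      X.scheme.presheaf.germ V'.U V.generic.1 hc (res a * ↑u⁻¹) = f V.generic := by
    intro f a ha
    rw [map_mul, hres, ← ha, ← hres b, ← hu, mul_right_comm, ← map_mul, Units.mul_inv, map_one,
      one_mul]
  refine ⟨V', hc, fun f hf => ?_, f₀, hf₀L, res a₀ * ↑u⁻¹, ?_, hdiv f₀ a₀ ha₀⟩
  · obtain ⟨a, ha⟩ := hbL f hf
    exact ⟨_, hdiv f a ha⟩
  · exact (isUnit_of_mul_isUnit_right hcu').mul u⁻¹.isUnit

/-- Enlarging an admissible set by a nowhere dense closed set preserves admissibility. -/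
theorem IsAdmissible.mono {n : ℕ} (hX : X.IsEquidimensional n) {L : Fin n → X.KRat}
    {S T : Set X.scheme} (hS : IsAdmissible L S) (hST : S ⊆ T) (hT : IsClosed T)
    (hη : ∀ η : X.GenericPoint, η.1 ∉ T) : IsAdmissible L T := by
  have hdim := (topologicalKrullDim_lt_iff hX hT).mpr hη
  refine ⟨hT, hS.2.1.trans hST, hdim, fun i => ⟨hT, hS.2.1.trans hST, hdim, fun z hz hf => ?_,
    (hS.2.2.2 i).baseLocus_subset.trans hST⟩⟩
  exact ((hS.2.2.2 i).pole_subset z hz hf).trans hST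

/-- The complement of the union of the charts of `KRat.exists_chart_regular` contains all poles and
base points of `L i`. -/
theorem exists_isAdmissible {n : ℕ} (hX : X.IsEquidimensional n) (L : Fin n → X.KRat) :
    ∃ S, IsAdmissible L S := by
  choose V hV hreg f₀ hf₀ a₀ ha₀ hfa₀ using fun i η => (L i).exists_chart_regular η
  let S : Set X.scheme := (X.str.smoothLocus : Set X.scheme)ᶜ ∪
    ⋃ i, (⋃ η, ((V i η).U : Set X.scheme))ᶜ
  have hS : IsClosed S := X.str.smoothLocus.2.isClosed_compl.union
    (isClosed_iUnion_of_finite fun i => (isOpen_iUnion fun η => (V i η).U.2).isClosed_compl)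
  have hsing : (X.str.smoothLocus : Set X.scheme)ᶜ ⊆ S := Set.subset_union_left
  have hη : ∀ η : X.GenericPoint, η.1 ∉ S := by
    rintro η (h | h)
    · exact h η.mem_smoothLocus
    · obtain ⟨i, h⟩ := Set.mem_iUnion.mp h
      exact h (Set.mem_iUnion.mpr ⟨η, hV i η⟩)
  have hcover : ∀ i, ∀ z ∉ S, ∃ η, z ∈ (V i η).U := by
    intro i z hz
    by_contra! h
    refine hz (Or.inr (Set.mem_iUnion.mpr ⟨i, fun hz' => ?_⟩))
    obtain ⟨η, hzη⟩ := Set.mem_iUnion.mp hz'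
    exact h η hzη
  have hdim := (topologicalKrullDim_lt_iff hX hS).mpr hη
  have hgerm : ∀ (W : X.Chart) (η : X.GenericPoint) (h : η.1 ∈ W.U) (f : X.RatFun) (a : W.Ring),
      X.scheme.presheaf.germ W.U η.1 h a = f η → W.germ a = f W.generic := by
    intro W η h f a ha
    obtain rfl := W.eq_generic η h
    exact ha
  refine ⟨S, hS, hsing, hdim, fun i => ⟨hS, hsing, hdim, ?_, ?_⟩⟩
  · rintro z - ⟨f, hf, hz⟩
    refine closure_minimal (Set.singleton_subset_iff.mpr ?_) hS
    by_contra hzS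
    obtain ⟨η, hzη⟩ := hcover i z hzS
    obtain ⟨a, ha⟩ := hreg i η f hf
    exact hz ((V i η).isRegularAt hzη (hgerm _ η (hV i η) f a ha))
  · intro z hz
    by_contra hzS
    obtain ⟨η, hzη⟩ := hcover i z hzS
    have := ((V i η).vanishesAt_iff hzη (hgerm _ η (hV i η) _ _ (hfa₀ i η))).mp (hz _ (hf₀ i η))
    exact Ideal.IsPrime.ne_top (I := (V i η).prime z hzη) inferInstance
      (Ideal.eq_top_of_isUnit_mem _ this (ha₀ i η))

end ComplexVariety

/-! ### Systems of equations off an admissible set -/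

/-- A linear map whose values are liftable through an injective linear map lifts. -/
theorem LinearMap.exists_lift_of_injective {k E A F : Type*} [Field k] [AddCommGroup E] [Module k E]
    [AddCommGroup A] [Module k A] [AddCommGroup F] [Module k F] (j : A →ₗ[k] F)
    (hj : Function.Injective j) (g : E →ₗ[k] F) (h : ∀ e, ∃ a, j a = g e) :
    ∃ ρ : E →ₗ[k] A, ∀ e, j (ρ e) = g e := by
  refine ⟨(LinearEquiv.ofInjective j hj).symm.toLinearMap ∘ₗ g.codRestrict _ h, fun e => ?_⟩
  have := LinearEquiv.apply_symm_apply (LinearEquiv.ofInjective j hj) (g.codRestrict _ h e)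
  exact congr(($this).1)

namespace ComplexVariety

variable {X : ComplexVariety}

namespace Chart

variable (V : X.Chart)

/-- Codimension in a chart is codimension in `X`. -/
theorem height_eq_coheight_point (p : PrimeSpectrum V.Ring) :
    p.asIdeal.height = Order.coheight (V.point p) := by
  rw [idealHeight_eq_coheight (R := Γ(X.scheme, V.U)) p]
  exact (coheight_eq_of_isOpenImmersion V.isAffineOpen.fromSpec).symm

/-- The coordinate ring of a chart is integrally closed at the smooth points. -/
theorem exists_denominator_of_isIntegral (p : PrimeSpectrum V.Ring)
    (hp : V.point p ∈ X.str.smoothLocus) :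
    letI := V.germ.toRingHom.toAlgebra
    ∀ g : X.scheme.presheaf.stalk V.generic.1, IsIntegral V.Ring g →
      ∃ s ∉ p.asIdeal, ∃ a, V.germ s * g = V.germ a := by
  let _ : Algebra V.Ring (X.scheme.presheaf.stalk V.generic.1) := V.germ.toRingHom.toAlgebra
  intro g hg
  obtain ⟨hdom, hint⟩ := isDomain_and_isIntegrallyClosed_stalk hp
  have hx := V.point_mem p
  have hsp := V.generic_specializes _ hx
  let O := X.scheme.presheaf.stalk (V.point p)
  let F := X.scheme.presheaf.stalk V.generic.1
  let _ : Algebra O F := (X.scheme.presheaf.stalkSpecializes hsp).hom.toAlgebra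
  let _ : Algebra V.Ring O := (X.scheme.presheaf.germ V.U _ hx).hom.toAlgebra
  have htower : IsScalarTower V.Ring O F := IsScalarTower.of_algebraMap_eq fun a =>
    (TopCat.Presheaf.germ_stalkSpecializes_apply _ _ hsp a).symm
  have _ : IsFractionRing V.Ring F := V.isFractionRing
  have hloc : IsLocalization (V.isAffineOpen.primeIdealOf ⟨V.point p, hx⟩).asIdeal.primeCompl O :=
    V.isAffineOpen.isLocalization_stalk ⟨V.point p, hx⟩
  have _ : IsFractionRing O F := IsFractionRing.isFractionRing_of_isDomain_of_isLocalization
    (V.isAffineOpen.primeIdealOf ⟨V.point p, hx⟩).asIdeal.primeCompl O F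
  obtain ⟨z, hz⟩ := (isIntegrallyClosed_iff F).mp hint (hg.tower_top (A := O))
  obtain ⟨b, hb, a, hab⟩ := exists_germ_mul_eq_germ V.isAffineOpen hx z
  have hprime : (V.isAffineOpen.primeIdealOf ⟨V.point p, hx⟩).asIdeal = p.asIdeal := V.prime_point p
  refine ⟨b, hprime ▸ hb, a, ?_⟩
  have h1 := congrArg (algebraMap O F) hab
  rw [map_mul, hz] at h1
  have h2 : ∀ c : V.Ring, algebraMap O F (X.scheme.presheaf.germ V.U _ hx c) = V.germ c :=
    fun c => (IsScalarTower.algebraMap_apply V.Ring O F c).symm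
  rw [h2, h2] at h1
  exact h1

/-- The functions of `L` are regular off an admissible set: they have no poles of codimension one
there, and smooth varieties are normal. -/
theorem exists_germ_eq {n : ℕ} {L : X.KRat} {S : Set X.scheme} (hS : L.IsAdmissible n S)
    (hV : ∀ x ∈ V.U, x ∉ S) {f : X.RatFun} (hf : f ∈ L.space) : ∃ a, V.germ a = f V.generic := by
  let _ : Algebra V.Ring (X.scheme.presheaf.stalk V.generic.1) := V.germ.toRingHom.toAlgebra
  have hfr : IsFractionRing V.Ring (X.scheme.presheaf.stalk V.generic.1) := V.isFractionRing
  have _ := finiteType_section V.isAffineOpen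
  have _ : IsNoetherianRing V.Ring := Algebra.FiniteType.isNoetherianRing ℂ V.Ring
  -- the ideal of denominators
  let I : Ideal V.Ring :=
    { carrier := {s | ∃ a, V.germ s * f V.generic = V.germ a}
      add_mem' := fun {s t} ⟨a, ha⟩ ⟨b, hb⟩ => ⟨a + b, by rw [map_add, add_mul, ha, hb, map_add]⟩
      zero_mem' := ⟨0, by rw [map_zero, zero_mul]⟩
      smul_mem' := fun c s ⟨a, ha⟩ =>
        ⟨c * a, by rw [smul_eq_mul, map_mul, mul_assoc, ha, map_mul]⟩ }
  suffices h : I = ⊤ by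
    obtain ⟨a, ha⟩ : (1 : V.Ring) ∈ I := h ▸ Submodule.mem_top
    rw [map_one, one_mul] at ha
    exact ⟨a, ha.symm⟩
  by_contra hI
  obtain ⟨m, hm, hIm⟩ := Ideal.exists_le_maximal I hI
  have hmp := hm.isPrime
  have hsm : V.point ⟨m, hmp⟩ ∈ X.str.smoothLocus := by
    by_contra h
    exact hV _ (V.point_mem _) (hS.singular_subset h)
  let _ : Field (X.scheme.presheaf.stalk V.generic.1) := IsFractionRing.toField V.Ring
  obtain ⟨s, hs, a, ha⟩ := exists_denominator_notMem_of_height_one (A := V.Ring)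
    (F := X.scheme.presheaf.stalk V.generic.1) m
    (V.exists_denominator_of_isIntegral ⟨m, hmp⟩ hsm) (f V.generic) <| by
      intro q hq hqm hq1
      have hz : Order.coheight (V.point ⟨q, hq⟩) = 1 := by
        rw [← V.height_eq_coheight_point]; exact hq1
      have hreg : RatFun.IsRegularAt f (V.point ⟨q, hq⟩) := by
        by_contra h
        exact hV _ (V.point_mem _) (hS.pole_subset _ hz ⟨f, hf, h⟩ (subset_closure rfl))
      obtain ⟨b, hb, a, hab⟩ := V.exists_denominator_of_isRegularAt (V.point_mem _) hreg
      rw [V.prime_point] at hb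
      exact ⟨b, hb, a, hab⟩
  exact hs (hIm ⟨a, ha⟩)

end Chart

/-- The complement of an admissible set is covered by finitely many charts, to which the systems of
equations restrict. -/
theorem exists_systemAtlas {n : ℕ} (hX : X.IsEquidimensional n) (L : Fin n → X.KRat)
    {S : Set X.scheme} (hS : IsAdmissible L S) :
    ∃ 𝒜 : SystemAtlas ℂ X.scheme (fun i => (L i).space),
      (∀ f : ∀ i, (L i).space, 𝒜.solutionsOff (fun _ => ⊤) f = solutions S fun i => (f i).1) ∧
      ∀ T, IsClosed T → S ⊆ T → ∃ J : ∀ c, Ideal (𝒜.A c),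
        (∀ f : ∀ i, (L i).space, 𝒜.solutionsOff J f = solutions T fun i => (f i).1) ∧
        ((∀ η : X.GenericPoint, η.1 ∉ T) → ∀ c, J c ≠ ⊥) := by
  classical
  have hsm : ∀ x, x ∉ S → x ∈ X.str.smoothLocus := fun x hx => by
    by_contra h
    exact hx (hS.2.1 h)
  choose W hxW hWS using fun x : {x // x ∉ S} =>
    exists_chart (hsm x.1 x.2) ⟨Sᶜ, hS.1.isOpen_compl⟩ x.2
  have hcomp : IsCompact Sᶜ := TopologicalSpace.NoetherianSpace.isCompact _
  obtain ⟨t, ht⟩ := hcomp.elim_finite_subcover (fun x => ((W x).U : Set X.scheme))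
    (fun x => (W x).U.2) fun x hx => Set.mem_iUnion.mpr ⟨⟨x, hx⟩, hxW _⟩
  have hcover : ∀ x, x ∉ S → ∃ c : t, x ∈ (W c).U := by
    intro x hx
    obtain ⟨c, hc, hxc⟩ := Set.mem_iUnion₂.mp (ht hx)
    exact ⟨⟨c, hc⟩, hxc⟩
  have hdisj : ∀ c : t, ∀ x ∈ (W c).U, x ∉ S := fun c x hx => hWS c hx
  choose ρ hρ using fun (c : t) (i : Fin n) =>
    LinearMap.exists_lift_of_injective (W c).germ.toLinearMap (W c).germ_injective
      ((LinearMap.proj (R := ℂ) (φ := fun η : X.GenericPoint => X.scheme.presheaf.stalk η.1)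
        (W c).generic) ∘ₗ (L i).space.subtype)
      fun f => (W c).exists_germ_eq (hS.2.2.2 i) (hdisj c) f.2
  have hρ' : ∀ (c : t) i (f : (L i).space), (W c).germ (ρ c i f) = f.1 (W c).generic := hρ
  choose I hI using fun c d : t => (W c).exists_ideal_diagonal (W d)
  let 𝒜 : SystemAtlas ℂ X.scheme (fun i => (L i).space) :=
    { κ := t
      finite := inferInstance
      A := fun c => (W c).Ring
      commRing := fun c => inferInstance
      isDomain := fun c => inferInstance
      algebra := fun c => inferInstance
      finiteType := fun c => finiteType_section (W c).isAffineOpen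
      dim_le := fun c => ((W c).ringKrullDim_and_height_eq hX).1.le
      le_height := fun c φ => (((W c).ringKrullDim_and_height_eq hX).2 _ ((W c).isMaximal_ker φ)).ge
      ρ := ρ
      exists_ne_zero := fun c i φ => by
        have h1 : (W c).homPoint φ ∉ (L i).baseLocus := fun h =>
          hdisj c _ ((W c).homPoint_mem φ) ((hS.2.2.2 i).baseLocus_subset h)
        simp only [KRat.baseLocus, Set.mem_ofPred_eq, not_forall] at h1
        obtain ⟨f, hf, hfv⟩ := h1
        exact ⟨⟨f, hf⟩, fun h => hfv (((W c).vanishesAt_homPoint_iff (hρ' c i ⟨f, hf⟩) φ).mpr h)⟩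
      pt := fun c => (W c).homPoint
      pt_injective := fun c => (W c).homPoint_injective
      exists_separator := fun c d φ ψ h => by
        rw [Ne, hI c d] at h
        push Not at h
        obtain ⟨a, ha, ha0⟩ := h
        exact ⟨a, ha0, fun φ' ψ' h' heq => h' ((hI c d φ' ψ').mp heq a ha)⟩ }
  -- solutions off a closed set, in terms of an ideal of each chart
  have hsol : ∀ (T : Set X.scheme) (J : ∀ c, Ideal (𝒜.A c)), S ⊆ T →
      (∀ (c : t) (φ : (W c).Ring →ₐ[ℂ] ℂ), J c ≤ RingHom.ker φ ↔ (W c).homPoint φ ∈ T) →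
      ∀ f : ∀ i, (L i).space, 𝒜.solutionsOff J f = solutions T fun i => (f i).1 := by
    intro T J hST hJ f
    ext x
    constructor
    · rintro ⟨c, φ, rfl, hφ, hφJ⟩
      exact ⟨fun h => hφJ ((hJ c φ).mpr h), (W c).isClosed_homPoint φ, fun i =>
        ((W c).vanishesAt_homPoint_iff (hρ' c i (f i)) φ).mpr (hφ i)⟩
    · rintro ⟨hxT, hxc, hx⟩
      obtain ⟨c, hc⟩ := hcover x fun h => hxT (hST h)
      obtain ⟨φ, rfl⟩ := (W c).exists_homPoint_eq hc hxc
      exact ⟨c, φ, rfl, fun i => ((W c).vanishesAt_homPoint_iff (hρ' c i (f i)) φ).mp (hx i),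
        fun h => hxT ((hJ c φ).mp h)⟩
  refine ⟨𝒜, hsol S _ subset_rfl fun c φ => ?_, fun T hT hST => ?_⟩
  · exact iff_of_false (𝒜.not_top_le_ker c φ) (hdisj c _ ((W c).homPoint_mem φ))
  · let J : ∀ c, Ideal (𝒜.A c) := fun c =>
      PrimeSpectrum.vanishingIdeal ((W c).point ⁻¹' T)
    have hJ : ∀ (c : t) (p : PrimeSpectrum (W c).Ring), J c ≤ p.asIdeal ↔ (W c).point p ∈ T := by
      intro c p
      have h1 : IsClosed ((W c).point ⁻¹' T) := hT.preimage (W c).isOpenEmbedding_point.continuous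
      have h2 := PrimeSpectrum.zeroLocus_vanishingIdeal_eq_closure ((W c).point ⁻¹' T)
      rw [h1.closure_eq] at h2
      exact congr(p ∈ $h2).to_iff
    refine ⟨J, hsol T J hST fun c φ => hJ c ⟨RingHom.ker φ, RingHom.ker_isPrime _⟩, ?_⟩
    intro hη c h0
    exact hη (W c).generic ((hJ c ⟨⊥, Ideal.isPrime_bot⟩).mp h0.le)

/-- The number of solutions of a system off an admissible set `S` is bounded. -/
theorem bddAbove_rootCounts {n : ℕ} (hX : X.IsEquidimensional n) (L : Fin n → X.KRat)
    {S : Set X.scheme} (hS : IsAdmissible L S) : BddAbove (rootCounts S L) := by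
  obtain ⟨𝒜, h𝒜, -⟩ := exists_systemAtlas hX L hS
  have _ := fun i => (L i).finiteDimensional
  obtain ⟨N, hN⟩ := 𝒜.exists_bound
  refine ⟨N, ?_⟩
  rintro _ ⟨f, hf, hfin, rfl⟩
  have := hN fun i => ⟨f i, hf i⟩
  rw [h𝒜] at this
  exact this hfin

/-- A system with finitely many solutions off `R ⊇ S` can be perturbed to a system with at least as
many solutions off the admissible set `S`, none of which lies in the nowhere dense set `T ⊇ S`. -/
theorem exists_perturbation {n : ℕ} (hX : X.IsEquidimensional n) (L : Fin n → X.KRat)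
    {S R T : Set X.scheme} (hS : IsAdmissible L S) (hR : IsClosed R) (hSR : S ⊆ R)
    (hT : IsClosed T) (hST : S ⊆ T) (hη : ∀ η : X.GenericPoint, η.1 ∉ T)
    (f : Fin n → X.RatFun) (hf : ∀ i, f i ∈ (L i).space) (hfin : (solutions R f).Finite) :
    ∃ f' : Fin n → X.RatFun, (∀ i, f' i ∈ (L i).space) ∧ (solutions S f').Finite ∧
      solutions S f' = solutions T f' ∧ (solutions R f).ncard ≤ (solutions S f').ncard := by
  obtain ⟨𝒜, h𝒜, hJ⟩ := exists_systemAtlas hX L hS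
  obtain ⟨J, hJR, -⟩ := hJ R hR hSR
  obtain ⟨J', hJT, hJ'⟩ := hJ T hT hST
  obtain ⟨f', h1, h2, h3⟩ := 𝒜.exists_perturbation J J' (hJ' hη) (fun i => ⟨f i, hf i⟩)
    (by rw [hJR]; exact hfin)
  rw [h𝒜] at h1 h2 h3
  rw [hJT] at h2
  rw [hJR] at h3
  exact ⟨fun i => (f' i).1, fun i => (f' i).2, h1, h2, h3⟩

end ComplexVariety

/-! ### The intersection index -/

namespace ComplexVariety

variable {X : ComplexVariety}

/-- Some system has finitely many solutions: perturb the zero system, whose set of solutions off the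
whole of `X` is empty. -/
theorem rootCounts_nonempty {n : ℕ} (hX : X.IsEquidimensional n) (L : Fin n → X.KRat)
    {S : Set X.scheme} (hS : IsAdmissible L S) : (rootCounts S L).Nonempty := by
  obtain ⟨f, hf, hfin, -, -⟩ := exists_perturbation hX L hS isClosed_univ (Set.subset_univ S) hS.1
    subset_rfl ((topologicalKrullDim_lt_iff hX hS.1).mp hS.2.2.1) 0 (fun i => zero_mem _)
    (by simp [solutions])
  exact ⟨_, f, hf, hfin, rfl⟩

theorem isGreatest_indexOnCompl {n : ℕ} (hX : X.IsEquidimensional n) (L : Fin n → X.KRat)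
    {S : Set X.scheme} (hS : IsAdmissible L S) :
    IsGreatest (rootCounts S L) (indexOnCompl S L) :=
  ⟨Nat.sSup_mem (rootCounts_nonempty hX L hS) (bddAbove_rootCounts hX L hS),
    fun _ h => le_csSup (bddAbove_rootCounts hX L hS) h⟩

/-- Enlarging an admissible set does not change the index: by a perturbation, the solutions can be
moved off the larger set. -/
theorem indexOnCompl_eq_of_subset {n : ℕ} (hX : X.IsEquidimensional n) (L : Fin n → X.KRat)
    {S T : Set X.scheme} (hS : IsAdmissible L S) (hT : IsAdmissible L T) (hST : S ⊆ T) :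
    indexOnCompl S L = indexOnCompl T L := by
  have hη := (topologicalKrullDim_lt_iff hX hT.1).mp hT.2.2.1
  have hgS := isGreatest_indexOnCompl hX L hS
  have hgT := isGreatest_indexOnCompl hX L hT
  apply le_antisymm
  · obtain ⟨f, hf, hfin, hk⟩ := hgS.1
    obtain ⟨f', hf', hfin', heq, hle⟩ :=
      exists_perturbation hX L hS hS.1 subset_rfl hT.1 hST hη f hf hfin
    rw [← hk]
    exact hle.trans (hgT.2 ⟨f', hf', heq ▸ hfin', by rw [heq]⟩)
  · obtain ⟨f, hf, hfin, hk⟩ := hgT.1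
    obtain ⟨f', hf', hfin', -, hle⟩ :=
      exists_perturbation hX L hS hT.1 hST hT.1 hST hη f hf hfin
    rw [← hk]
    exact hle.trans (hgS.2 ⟨f', hf', hfin', rfl⟩)

theorem IsAdmissible.union {n : ℕ} (hX : X.IsEquidimensional n) {L L' : Fin n → X.KRat}
    {S S' : Set X.scheme} (hS : IsAdmissible L S) (hS' : IsAdmissible L' S') :
    IsAdmissible L (S ∪ S') :=
  hS.mono hX Set.subset_union_left (hS.1.union hS'.1) fun η h =>
    h.elim ((topologicalKrullDim_lt_iff hX hS.1).mp hS.2.2.1 η)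
      ((topologicalKrullDim_lt_iff hX hS'.1).mp hS'.2.2.1 η)

theorem intersectionIndex_eq {n : ℕ} (hX : X.IsEquidimensional n) (L : Fin n → X.KRat)
    {S : Set X.scheme} (hS : IsAdmissible L S) : intersectionIndex L = indexOnCompl S L := by
  have h : ∃ S, IsAdmissible L S := ⟨S, hS⟩
  rw [intersectionIndex, dif_pos h,
    indexOnCompl_eq_of_subset hX L h.choose_spec (h.choose_spec.union hX hS) Set.subset_union_left]
  exact (indexOnCompl_eq_of_subset hX L hS (h.choose_spec.union hX hS)
    Set.subset_union_right).symm

theorem IsAdmissible.comp_perm {n : ℕ} {L : Fin n → X.KRat} {S : Set X.scheme}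
    (hS : IsAdmissible L S) (σ : Equiv.Perm (Fin n)) : IsAdmissible (fun i => L (σ i)) S :=
  ⟨hS.1, hS.2.1, hS.2.2.1, fun i => hS.2.2.2 (σ i)⟩

theorem rootCounts_subset_comp_perm {n : ℕ} (S : Set X.scheme) (L : Fin n → X.KRat)
    (σ : Equiv.Perm (Fin n)) : rootCounts S L ⊆ rootCounts S (fun i => L (σ i)) := by
  rintro k ⟨f, hf, hfin, hk⟩
  have : solutions S (fun i => f (σ i)) = solutions S f := by
    ext x
    exact and_congr_right fun _ => and_congr_right fun _ =>
      σ.forall_congr_right (q := fun i => RatFun.VanishesAt (f i) x)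
  exact ⟨fun i => f (σ i), fun i => hf (σ i), this ▸ hfin, this ▸ hk⟩

end ComplexVariety

theorem mainTheorem10 (X : ComplexVariety) (n : ℕ) (hX : X.IsEquidimensional n) :
    -- the index is well defined: admissible sets exist, and for each of them
    -- the maximal number of roots is attained and is the index
    (∀ L : Fin n → X.KRat, (∃ S, ComplexVariety.IsAdmissible L S) ∧
      ∀ S, ComplexVariety.IsAdmissible L S →
        IsGreatest (ComplexVariety.rootCounts S L) (ComplexVariety.intersectionIndex L)) ∧
    -- symmetry
    (∀ (L : Fin n → X.KRat) (σ : Equiv.Perm (Fin n)),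
      ComplexVariety.intersectionIndex (fun i => L (σ i)) =
        ComplexVariety.intersectionIndex L) ∧
    -- monotonicity
    (∀ L' L : Fin n → X.KRat, (∀ i, (L' i).space ≤ (L i).space) →
      ComplexVariety.intersectionIndex L' ≤ ComplexVariety.intersectionIndex L) ∧
    -- non-negativity
    (∀ L : Fin n → X.KRat, 0 ≤ ComplexVariety.intersectionIndex L) := by
  have hgreatest : ∀ (L : Fin n → X.KRat) S, ComplexVariety.IsAdmissible L S →
      IsGreatest (ComplexVariety.rootCounts S L) (ComplexVariety.intersectionIndex L) :=
    fun L S hS => ComplexVariety.intersectionIndex_eq hX L hS ▸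
      ComplexVariety.isGreatest_indexOnCompl hX L hS
  refine ⟨fun L => ⟨ComplexVariety.exists_isAdmissible hX L, hgreatest L⟩, fun L σ => ?_,
    fun L' L h => ?_, fun L => Nat.zero_le _⟩
  · obtain ⟨S, hS⟩ := ComplexVariety.exists_isAdmissible hX L
    have hle : ∀ (L : Fin n → X.KRat), ComplexVariety.IsAdmissible L S →
        ∀ σ : Equiv.Perm (Fin n), ComplexVariety.intersectionIndex L ≤
          ComplexVariety.intersectionIndex fun i => L (σ i) := fun L hS σ =>
      (hgreatest _ S (hS.comp_perm σ)).2
        (ComplexVariety.rootCounts_subset_comp_perm S L σ (hgreatest L S hS).1)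
    refine le_antisymm ?_ (hle L hS σ)
    have := hle _ (hS.comp_perm σ) σ⁻¹
    simpa using this
  · obtain ⟨S, hS⟩ := ComplexVariety.exists_isAdmissible hX L
    obtain ⟨S', hS'⟩ := ComplexVariety.exists_isAdmissible hX L'
    have hU := hS.union hX hS'
    have hU' := Set.union_comm S' S ▸ hS'.union hX hS
    obtain ⟨f, hf, hfin, hk⟩ := (hgreatest L' _ hU').1
    exact (hgreatest L _ hU).2 ⟨f, fun i => h i (hf i), hfin, hk⟩
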